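/- **Setting.** Call an imaginary root (eigenvalue) one that is not real. An integer polynomial $C$ is *of type $\mathcal J$* if $C=B_0B_1\cdots B_k$ with $k\ge 1$ and $B_i\in\mathbb Z[t]$ such that $B_0$ has no real roots; each $B_i$ with $i\ge1$ is irreducible and has at least one real and at least one imaginary root; and $(B_i)+(B_j)=\mathbb Z[t]$ for all $i\neq j$. A matrix $M\in SL(N,\mathbb Z)$ is *of type $\mathcal J$* if its characteristic polynomial is. Its real eigenvalues $\alpha_1,\dots,\alpha_s$ are then simple, and $N=s+2n$ with $s,n>0$. A family $\xi_1,\dots,\xi_s$ in $(\mathbb R_{>0})^s$ is a *log-basis* if the vectors of coordinatewise logarithms form a basis of $\mathbb R^s$. A *Dirichlet family for $M$* is a family $\mathcal D=(D_1,\dots,D_s)$ in $\mathbb Z[t]$ such that $D_i(M)\in SL(N,\mathbb Z)$ for all $i$, $D_i(\alpha_j)>0$ for all $i,j$, and the vectors $(D_i(\alpha_1),\dots,D_i(\alpha_s))$, $1\le i\le s$, form a log-basis. It is *primary* if, for some factorization $B_0\cdots B_k$ as above of the characteristic polynomial of $M$, with $\gamma_{j,1},\dots,\gamma_{j,s_j}$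 the real roots of $B_j$ ($1\le j\le k$), there are polynomials $P_{j,i}\in\mathbb Z[t]$ ($1\le j\le k$, $1\le i\le s_j$) that are invertible in $\mathbb Z[t]/(B_j)$, are positive at all $\gamma_{j,l}$, and are such that for each $j$ the vectors $(P_{j,i}(\gamma_{j,1}),\dots,P_{j,i}(\gamma_{j,s_j}))$, $1\le i\le s_j$, form a log-basis, and the family $\mathcal D$ can be re-indexed as $(D_{j,i})$ with $$D_{j,i}\equiv t \bmod B_0,\qquad D_{j,i}\equiv P_{j,i}\bmod B_j,\qquad D_{j,i}\equiv 1\bmod B_\mu\quad(\mu\ne 0,j).$$ **The manifold $T(M,\mathcal D)$.** Choose real eigenvectors $a_1,\dots,a_s\in\mathbb R^N$ of $M$ for $\alpha_1,\dots,\alpha_s$, choose one eigenvalue from each pair of complex conjugate imaginary eigenvalues of $M$, let $W\subset\mathbb C^N$ be the sum of the corresponding generalized eigenspaces, choose a basis $b_1,\dots,b_n$ of $W$, and let $R$ be the matrix of $M|_W$ in this basis. Let $\mathbb H$ be the upper half-plane. Let $G\cong\mathbb Z^s\ltimes\mathbb Z^{N}$ be the group of biholomorphisms of $\mathbb H^s\times\mathbb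 C^n$ generated by $$g_i(w,z)=\big(D_i(\alpha_1)w_1,\dots,D_i(\alpha_s)w_s,\;D_i(R^\top)z\big),\qquad 1\le i\le s,$$ and by the translations by $v_k=(a_1^{(k)},\dots,a_s^{(k)},b_1^{(k)},\dots,b_n^{(k)})\in\mathbb R^s\times\mathbb C^n$, $1\le k\le N$, where the superscript $(k)$ denotes the $k$-th coordinate. Then $T(M,\mathcal D)=(\mathbb H^s\times\mathbb C^n)/G$, with the complex structure for which the projection from $\mathbb H^s\times\mathbb C^n$ is locally biholomorphic. A *locally conformally Kähler structure* on a complex manifold is a Hermitian metric whose fundamental $2$-form $\Omega$ satisfies $d\Omega=\theta\wedge\Omega$ for some closed real $1$-form $\theta$; it is a *Kähler structure* if $d\Omega=0$. **Theorem.** Let $M\in SL(N,\mathbb Z)$ be a matrix of type $\mathcal J$ and let $\mathcal D=(D_1,\dots,D_s)$ be a primary Dirichlet family for $M$. Suppose that at least one of the matrices $D_i(M)$ is not diagonalizable over $\mathbb C$. Then, for all choices made in the construction, the complex manifold $T(M,\mathcal D)$ admits no locally conformally Kähler structure; in particular, it admits no Kähler structure. -/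

import Mathlib

open Polynomial Matrix
open scoped Manifold ContDiff

noncomputable section

namespace DirichletManifold

/-! ### Matrices of type J -/

/-- `B 0, …, B k` (with `k ≥ 1`) is a factorization of `C` of type J: `B 0` has no real root, each
`B i` with `i ≥ 1` is irreducible and has both a real and a non-real root, and distinct factors are
strongly coprime, i.e. `(B i) + (B j) = ℤ[t]`. -/
structure IsJFactorization (C : ℤ[X]) {k : ℕ} (B : Fin (k + 1) → ℤ[X]) : Prop where
  pos : 0 < k
  prod : C = ∏ i, B i
  noRealRoot : ∀ x : ℝ, aeval x (B 0) ≠ 0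
  irred : ∀ i, i ≠ 0 → Irreducible (B i)
  realRoot : ∀ i, i ≠ 0 → ∃ x : ℝ, aeval x (B i) = 0
  nonrealRoot : ∀ i, i ≠ 0 → ∃ z : ℂ, z.im ≠ 0 ∧ aeval z (B i) = 0
  coprime : ∀ i j, i ≠ j → IsCoprime (B i) (B j)

/-- A polynomial of type J. -/
def IsTypeJPoly (C : ℤ[X]) : Prop :=
  ∃ (k : ℕ) (B : Fin (k + 1) → ℤ[X]), IsJFactorization C B

/-- A matrix of type J: its characteristic polynomial is of type J. -/
def IsTypeJ {N : ℕ} (M : Matrix (Fin N) (Fin N) ℤ) : Prop :=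
  IsTypeJPoly M.charpoly

/-- `α 1, …, α s` is a list without repetition of all real roots of `P`. -/
structure EnumeratesRealRoots (P : ℤ[X]) {s : ℕ} (α : Fin s → ℝ) : Prop where
  inj : Function.Injective α
  isRoot_iff : ∀ x : ℝ, aeval x P = 0 ↔ ∃ j, α j = x

/-- A family of `s` vectors with positive coordinates in `ℝ^s` is a log-basis if the vectors of
coordinatewise logarithms form a basis of `ℝ^s`. -/
structure IsLogBasis {s : ℕ} (ξ : Fin s → Fin s → ℝ) : Prop where
  pos : ∀ i j, 0 < ξ i j
  linInd : LinearIndependent ℝ (fun i => fun j => Real.log (ξ i j))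
  span : Submodule.span ℝ (Set.range fun i => fun j => Real.log (ξ i j)) = ⊤

/-- Dirichlet family for `M`, whose real eigenvalues are `α 1, …, α s`. -/
structure IsDirichletFamily {N s : ℕ} (M : Matrix (Fin N) (Fin N) ℤ) (α : Fin s → ℝ)
    (D : Fin s → ℤ[X]) : Prop where
  det : ∀ i, (aeval M (D i)).det = 1
  pos : ∀ i j, 0 < aeval (α j) (D i)
  logBasis : IsLogBasis (fun i j => aeval (α j) (D i))

/-- A primary Dirichlet family: for a factorization `B 0 ⋯ B k` of type J of the characteristic
polynomial, with `γ j 1, …, γ j (r j)` the real roots of `B j`, `j ≥ 1`, there are polynomials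
`P j i`, `1 ≤ i ≤ r j`, invertible modulo `B j`, positive at the real roots of `B j` and whose values
there form a log-basis, such that the family `D`, re-indexed by the pairs `(j, i)`, satisfies
`D (j, i) ≡ t mod B 0`, `D (j, i) ≡ P j i mod B j` and `D (j, i) ≡ 1 mod B μ` for the other `μ`.
(Here `j : Fin k` stands for the index `j.succ` of the factorization.) -/
structure IsPrimaryDirichletFamily {N s : ℕ} (M : Matrix (Fin N) (Fin N) ℤ) (α : Fin s → ℝ)
    (D : Fin s → ℤ[X]) : Prop extends IsDirichletFamily M α D where
  primary : ∃ (k : ℕ) (B : Fin (k + 1) → ℤ[X]) (r : Fin k → ℕ) (γ : ∀ j, Fin (r j) → ℝ)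
    (P : ∀ j, Fin (r j) → ℤ[X]) (e : (Σ j : Fin k, Fin (r j)) ≃ Fin s),
    IsJFactorization M.charpoly B ∧
    (∀ j, EnumeratesRealRoots (B j.succ) (γ j)) ∧
    (∀ j i, IsUnit (Ideal.Quotient.mk (Ideal.span {B j.succ}) (P j i))) ∧
    (∀ j i l, 0 < aeval (γ j l) (P j i)) ∧
    (∀ j, IsLogBasis (fun i l => aeval (γ j l) (P j i))) ∧
    (∀ j i, B 0 ∣ D (e ⟨j, i⟩) - X) ∧
    (∀ j i, B j.succ ∣ D (e ⟨j, i⟩) - P j i) ∧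
    (∀ j i μ, μ ≠ j → B μ.succ ∣ D (e ⟨j, i⟩) - 1)

/-! ### The spectral data -/

/-- The sum of the generalized eigenspaces in `ℂ^N` of `M` for the eigenvalues in `S`. -/
def genEigenSum {N : ℕ} (M : Matrix (Fin N) (Fin N) ℤ) (S : Set ℂ) : Submodule ℂ (Fin N → ℂ) :=
  ⨆ β ∈ S, Module.End.maxGenEigenspace (Matrix.toLin' (M.map (Int.cast : ℤ → ℂ))) β

theorem genEigenSum_invariant {N : ℕ} (M : Matrix (Fin N) (Fin N) ℤ) (S : Set ℂ) :
    ∀ x ∈ genEigenSum M S, Matrix.toLin' (M.map (Int.cast : ℤ → ℂ)) x ∈ genEigenSum M S := by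
  set f := Matrix.toLin' (M.map (Int.cast : ℤ → ℂ)) with hf
  intro x hx
  have h : genEigenSum M S ≤ (genEigenSum M S).comap f := by
    refine iSup₂_le fun β hβ x hx => ?_
    have h1 := Module.End.mapsTo_maxGenEigenspace_of_comm (Commute.refl f) β hx
    exact (le_iSup₂_of_le (f := fun β (_ : β ∈ S) => Module.End.maxGenEigenspace f β)
      β hβ le_rfl) h1
  exact h hx

/-- The choices entering the construction of `T(M, 𝒟)`: an enumeration `α` of the real eigenvalues
of `M`, a real eigenvector `a j` for each of them, a set `S` consisting of one eigenvalue from each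
pair of complex conjugate non-real eigenvalues, and a basis `b` of the sum `W` of the corresponding
generalized eigenspaces. -/
structure SpectralData {N : ℕ} (M : Matrix (Fin N) (Fin N) ℤ) (s n : ℕ) where
  α : Fin s → ℝ
  α_roots : EnumeratesRealRoots M.charpoly α
  a : Fin s → Fin N → ℝ
  a_ne : ∀ j, a j ≠ 0
  a_eigen : ∀ j, M.map (Int.cast : ℤ → ℝ) *ᵥ a j = α j • a j
  S : Set ℂ
  S_root : ∀ β ∈ S, aeval β M.charpoly = 0 ∧ β.im ≠ 0
  S_half : ∀ β : ℂ, aeval β M.charpoly = 0 → β.im ≠ 0 →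
    (β ∈ S ↔ starRingEnd ℂ β ∉ S)
  b : Module.Basis (Fin n) ℂ (genEigenSum M S)

/-- The complex vector space `ℂ^s × ℂ^n`. -/
abbrev Model (s n : ℕ) : Type := (Fin s → ℂ) × (Fin n → ℂ)

/-- The open subset `ℍ^s × ℂ^n` of `ℂ^s × ℂ^n`. -/
abbrev HC (s n : ℕ) : Type := {p : Model s n // ∀ j, 0 < (p.1 j).im}

namespace SpectralData

variable {N s n : ℕ} {M : Matrix (Fin N) (Fin N) ℤ}

/-- The matrix `R` in the basis `b` of the restriction of `M` to `W`. -/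
def R (Λ : SpectralData M s n) : Matrix (Fin n) (Fin n) ℂ :=
  LinearMap.toMatrix Λ.b Λ.b
    ((Matrix.toLin' (M.map (Int.cast : ℤ → ℂ))).restrict (genEigenSum_invariant M Λ.S))

/-- The vectors `v i = (a 1 i, …, a s i, b 1 i, …, b n i)`, `1 ≤ i ≤ N`, of
`ℝ^s × ℂ^n ⊆ ℂ^s × ℂ^n`, which generate the lattice of translations. -/
def v (Λ : SpectralData M s n) (i : Fin N) : Model s n :=
  (fun j => (Λ.a j i : ℂ), fun j => (Λ.b j : Fin N → ℂ) i)

/-- The linear map `(w, z) ↦ (P(α 1) w 1, …, P(α s) w s, P(Rᵀ) z)` of `ℂ^s × ℂ^n`. -/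
def op (Λ : SpectralData M s n) (P : ℤ[X]) : Model s n →ₗ[ℂ] Model s n :=
  LinearMap.prodMap
    (LinearMap.pi fun j => ((aeval (Λ.α j) P : ℝ) : ℂ) • LinearMap.proj j)
    (Matrix.mulVecLin (aeval Λ.Rᵀ P))

theorem op_fst (Λ : SpectralData M s n) (P : ℤ[X]) (x : Model s n) (j : Fin s) :
    (Λ.op P x).1 j = ((aeval (Λ.α j) P : ℝ) : ℂ) * x.1 j := by
  simp [op]

theorem op_snd (Λ : SpectralData M s n) (P : ℤ[X]) (x : Model s n) :
    (Λ.op P x).2 = aeval Λ.Rᵀ P *ᵥ x.2 := by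
  simp [op]

theorem op_mul (Λ : SpectralData M s n) (P Q : ℤ[X]) (x : Model s n) :
    Λ.op (P * Q) x = Λ.op P (Λ.op Q x) := by
  ext j
  · simp only [op_fst, map_mul]; push_cast; ring
  · simp only [op_snd, map_mul, Matrix.mulVec_mulVec]

theorem op_one (Λ : SpectralData M s n) (x : Model s n) : Λ.op 1 x = x := by
  ext j
  · simp [op_fst]
  · simp [op_snd]

theorem op_comm (Λ : SpectralData M s n) (P Q : ℤ[X]) (x : Model s n) :
    Λ.op P (Λ.op Q x) = Λ.op Q (Λ.op P x) := by
  rw [← op_mul, ← op_mul, mul_comm]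

/-- The matrix whose columns are the basis vectors of `W`. -/
def bMat (Λ : SpectralData M s n) : Matrix (Fin N) (Fin n) ℂ :=
  Matrix.of fun i j => (Λ.b j : Fin N → ℂ) i

theorem mul_bMat (Λ : SpectralData M s n) :
    M.map (Int.cast : ℤ → ℂ) * Λ.bMat = Λ.bMat * Λ.R := by
  ext i j
  have h := Λ.b.sum_repr
    (((Matrix.toLin' (M.map (Int.cast : ℤ → ℂ))).restrict (genEigenSum_invariant M Λ.S)) (Λ.b j))
  have h2 := congrFun (congrArg Subtype.val h) i
  rw [LinearMap.restrict_apply] at h2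
  simp only [Submodule.coe_sum, Finset.sum_apply, Submodule.coe_smul, Pi.smul_apply,
    smul_eq_mul, Matrix.toLin'_apply] at h2
  rw [Matrix.mul_apply, Matrix.mul_apply]
  simp only [Matrix.mulVec, dotProduct] at h2
  simp only [bMat, Matrix.of_apply, R, LinearMap.toMatrix_apply]
  rw [← h2]
  exact Finset.sum_congr rfl fun k _ => by rw [mul_comm]; rfl

theorem aeval_map_cast {K : Type*} [CommRing K] (P : ℤ[X]) :
    aeval (M.map (Int.cast : ℤ → K)) P = (aeval M P).map (Int.cast : ℤ → K) :=
  Polynomial.aeval_algHom_apply (AlgHom.mapMatrix (Algebra.ofId ℤ K)) M P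

theorem aeval_mul_bMat (Λ : SpectralData M s n) (P : ℤ[X]) :
    aeval (M.map (Int.cast : ℤ → ℂ)) P * Λ.bMat = Λ.bMat * aeval Λ.R P := by
  induction P using Polynomial.induction_on' with
  | add p q hp hq => simp [Matrix.add_mul, Matrix.mul_add, hp, hq]
  | monomial k c =>
    have h : ∀ k : ℕ, (M.map (Int.cast : ℤ → ℂ)) ^ k * Λ.bMat = Λ.bMat * Λ.R ^ k := by
      intro k
      induction k with
      | zero => simp
      | succ k ih => rw [pow_succ, Matrix.mul_assoc, mul_bMat, ← Matrix.mul_assoc, ih,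
          Matrix.mul_assoc, ← pow_succ]
    rw [Polynomial.aeval_monomial, Polynomial.aeval_monomial]
    simp only [← Algebra.smul_def, Matrix.smul_mul, Matrix.mul_smul, h]

theorem aeval_transpose {m : ℕ} (A : Matrix (Fin m) (Fin m) ℂ) (P : ℤ[X]) :
    aeval Aᵀ P = (aeval A P)ᵀ := by
  induction P using Polynomial.induction_on' with
  | add p q hp hq => simp [hp, hq]
  | monomial k c =>
    rw [Polynomial.aeval_monomial, Polynomial.aeval_monomial]
    simp only [← Algebra.smul_def, Matrix.transpose_smul, Matrix.transpose_pow]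

theorem aeval_mulVec_a (Λ : SpectralData M s n) (P : ℤ[X]) (j : Fin s) :
    aeval (M.map (Int.cast : ℤ → ℝ)) P *ᵥ Λ.a j = (aeval (Λ.α j) P) • Λ.a j := by
  induction P using Polynomial.induction_on' with
  | add p q hp hq => simp [Matrix.add_mulVec, add_smul, hp, hq]
  | monomial k c =>
    have h : ∀ k : ℕ, (M.map (Int.cast : ℤ → ℝ)) ^ k *ᵥ Λ.a j = (Λ.α j) ^ k • Λ.a j := by
      intro k
      induction k with
      | zero => simp
      | succ k ih => rw [pow_succ, ← Matrix.mulVec_mulVec, Λ.a_eigen, Matrix.mulVec_smul, ih,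
          smul_smul, pow_succ, mul_comm]
    rw [Polynomial.aeval_monomial, Polynomial.aeval_monomial]
    simp only [← Algebra.smul_def, Matrix.smul_mulVec, h, smul_assoc]

/-- The linear combination `∑ x i • v i`. -/
def lin (Λ : SpectralData M s n) : (Fin N → ℝ) →ₗ[ℝ] Model s n :=
  Fintype.linearCombination ℝ Λ.v

theorem lin_fst (Λ : SpectralData M s n) (x : Fin N → ℝ) (j : Fin s) :
    (Λ.lin x).1 j = ((x ⬝ᵥ Λ.a j : ℝ) : ℂ) := by
  simp [lin, Fintype.linearCombination_apply, v, Prod.fst_sum, dotProduct]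

theorem lin_snd (Λ : SpectralData M s n) (x : Fin N → ℝ) :
    (Λ.lin x).2 = Λ.bMatᵀ *ᵥ (fun i => (x i : ℂ)) := by
  ext j
  simp [lin, Fintype.linearCombination_apply, v, Prod.snd_sum, Matrix.mulVec, dotProduct, bMat,
    mul_comm]

theorem op_lin (Λ : SpectralData M s n) (P : ℤ[X]) (x : Fin N → ℝ) :
    Λ.op P (Λ.lin x) = Λ.lin (((aeval M P).map (Int.cast : ℤ → ℝ))ᵀ *ᵥ x) := by
  refine Prod.ext (funext fun j => ?_) ?_
  · rw [op_fst, lin_fst, lin_fst, ← Complex.ofReal_mul, Matrix.mulVec_transpose,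
      ← Matrix.dotProduct_mulVec, ← aeval_map_cast, aeval_mulVec_a, dotProduct_smul, smul_eq_mul]
  · rw [op_snd, lin_snd, lin_snd, aeval_transpose, Matrix.mulVec_mulVec, ← Matrix.transpose_mul,
      ← aeval_mul_bMat, aeval_map_cast, Matrix.transpose_mul, ← Matrix.mulVec_mulVec]
    congr 1
    ext i
    simp [Matrix.mulVec, dotProduct]

theorem det_R_ne (Λ : SpectralData M s n) (P : ℤ[X]) (hP : (aeval M P).det = 1) :
    (aeval Λ.R P).det ≠ 0 := by
  intro h
  obtain ⟨u, hu, hu0⟩ := Matrix.exists_mulVec_eq_zero_iff.mpr h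
  have h1 : ((aeval M P).map (Int.cast : ℤ → ℂ)) *ᵥ (Λ.bMat *ᵥ u) = 0 := by
    rw [Matrix.mulVec_mulVec, ← aeval_map_cast, aeval_mul_bMat, ← Matrix.mulVec_mulVec, hu0,
      Matrix.mulVec_zero]
  have hdet : ((aeval M P).map (Int.cast : ℤ → ℂ)).det = 1 := by
    have := (Int.castRingHom ℂ).map_det (aeval M P)
    rw [hP] at this
    simpa using this.symm
  have h2 : Λ.bMat *ᵥ u = 0 := by
    by_contra hne
    have := Matrix.exists_mulVec_eq_zero_iff.mp ⟨_, hne, h1⟩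
    rw [hdet] at this
    exact one_ne_zero this
  have h3 : ∑ j, u j • Λ.b j = 0 := by
    apply Subtype.ext
    ext i
    have := congrFun h2 i
    simpa [Matrix.mulVec, dotProduct, bMat, mul_comm] using this
  exact hu (funext fun j => Fintype.linearIndependent_iff.mp Λ.b.linearIndependent u h3 j)

theorem op_injective (Λ : SpectralData M s n) (P : ℤ[X]) (hP : (aeval M P).det = 1)
    (hpos : ∀ j, 0 < aeval (Λ.α j) P) : Function.Injective (Λ.op P) := by
  rw [← LinearMap.ker_eq_bot, LinearMap.ker_eq_bot']
  intro x hx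
  refine Prod.ext (funext fun j => ?_) ?_
  · have := congrFun (congrArg Prod.fst hx) j
    rw [op_fst] at this
    rcases mul_eq_zero.mp this with h | h
    · exact absurd (Complex.ofReal_eq_zero.mp h) (hpos j).ne'
    · exact h
  · have := congrArg Prod.snd hx
    rw [op_snd] at this
    by_contra hne
    have h := Matrix.exists_mulVec_eq_zero_iff.mp ⟨_, hne, this⟩
    rw [aeval_transpose, Matrix.det_transpose] at h
    exact Λ.det_R_ne P hP h

/-- `op P` as an automorphism, when `P(M)` is unimodular and `P` is positive on the real
eigenvalues. -/
def opEquiv (Λ : SpectralData M s n) (P : ℤ[X]) (hP : (aeval M P).det = 1)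
    (hpos : ∀ j, 0 < aeval (Λ.α j) P) : Model s n ≃L[ℂ] Model s n :=
  (LinearEquiv.ofInjectiveEndo (Λ.op P) (Λ.op_injective P hP hpos)).toContinuousLinearEquiv

theorem opEquiv_apply (Λ : SpectralData M s n) (P : ℤ[X]) (hP : (aeval M P).det = 1)
    (hpos : ∀ j, 0 < aeval (Λ.α j) P) (x : Model s n) : Λ.opEquiv P hP hpos x = Λ.op P x := rfl

/-- The map `g P` of `ℍ^s × ℂ^n` to itself,
`(w, z) ↦ (P(α 1) w 1, …, P(α s) w s, P(Rᵀ) z)`. -/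
def hcMap (Λ : SpectralData M s n) (P : ℤ[X]) (hpos : ∀ j, 0 < aeval (Λ.α j) P) (p : HC s n) :
    HC s n :=
  ⟨Λ.op P p.1, fun j => by
    rw [op_fst, Complex.im_ofReal_mul]; exact mul_pos (hpos j) (p.2 j)⟩

theorem hcMap_bijective (Λ : SpectralData M s n) (P : ℤ[X]) (hP : (aeval M P).det = 1)
    (hpos : ∀ j, 0 < aeval (Λ.α j) P) : Function.Bijective (Λ.hcMap P hpos) := by
  constructor
  · intro x y h
    exact Subtype.ext (Λ.op_injective P hP hpos (congrArg Subtype.val h))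
  · intro y
    obtain ⟨x, hx⟩ := (Λ.opEquiv P hP hpos).surjective y.1
    rw [opEquiv_apply] at hx
    refine ⟨⟨x, fun j => ?_⟩, Subtype.ext hx⟩
    have h := y.2 j
    rw [← hx, op_fst, Complex.im_ofReal_mul] at h
    exact (pos_iff_pos_of_mul_pos h).mp (hpos j)

/-- The translation of `ℍ^s × ℂ^n` by `v k`. -/
def trans (Λ : SpectralData M s n) (k : Fin N) : Equiv.Perm (HC s n) where
  toFun p := ⟨p.1 + Λ.v k, fun j => by simpa [v] using p.2 j⟩
  invFun p := ⟨p.1 - Λ.v k, fun j => by simpa [v] using p.2 j⟩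
  left_inv p := by simp
  right_inv p := by simp

variable {Λ : SpectralData M s n} {D : Fin s → ℤ[X]}

/-- The transformation
`g i : (w, z) ↦ (D i (α 1) w 1, …, D i (α s) w s, D i (Rᵀ) z)` of `ℍ^s × ℂ^n`. -/
def g (hD : IsDirichletFamily M Λ.α D) (i : Fin s) : Equiv.Perm (HC s n) :=
  Equiv.ofBijective (Λ.hcMap (D i) (hD.pos i)) (Λ.hcMap_bijective (D i) (hD.det i) (hD.pos i))

/-- The group `G ≅ ℤ^s ⋉ ℤ^N` of transformations of `ℍ^s × ℂ^n`, generated by the `g i` and the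
translations by the lattice vectors `v k`. -/
def group (hD : IsDirichletFamily M Λ.α D) : Subgroup (Equiv.Perm (HC s n)) :=
  Subgroup.closure (Set.range (g hD) ∪ Set.range Λ.trans)

theorem g_coe (hD : IsDirichletFamily M Λ.α D) (i : Fin s) (p : HC s n) :
    (g hD i p : HC s n).1 = Λ.op (D i) p.1 := rfl

theorem trans_coe (k : Fin N) (p : HC s n) : (Λ.trans k p).1 = p.1 + Λ.v k := rfl

/-- The group acts by restrictions of complex affine automorphisms. -/
theorem group_affine (hD : IsDirichletFamily M Λ.α D) (γ : Equiv.Perm (HC s n))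
    (hγ : γ ∈ group hD) :
    ∃ (A : Model s n ≃L[ℂ] Model s n) (c : Model s n), ∀ p, (γ p).1 = A p.1 + c := by
  induction hγ using Subgroup.closure_induction with
  | mem γ h =>
    rcases h with ⟨i, rfl⟩ | ⟨k, rfl⟩
    · exact ⟨Λ.opEquiv (D i) (hD.det i) (hD.pos i), 0, fun p => by
        rw [opEquiv_apply, add_zero, g_coe]⟩
    · exact ⟨ContinuousLinearEquiv.refl ℂ _, Λ.v k, fun p => rfl⟩
  | one => exact ⟨ContinuousLinearEquiv.refl ℂ _, 0, fun p => by simp⟩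
  | mul γ γ' _ _ h h' =>
    obtain ⟨A, c, h⟩ := h
    obtain ⟨A', c', h'⟩ := h'
    refine ⟨A'.trans A, A c' + c, fun p => ?_⟩
    rw [Equiv.Perm.mul_apply, h, h', map_add, add_assoc]; rfl
  | inv γ _ h =>
    obtain ⟨A, c, h⟩ := h
    refine ⟨A.symm, -A.symm c, fun p => ?_⟩
    have := h (γ⁻¹ p)
    rw [show γ (γ⁻¹ p) = p from γ.apply_symm_apply p] at this
    rw [this, map_add, A.symm_apply_apply]
    abel

instance (hD : IsDirichletFamily M Λ.α D) : ContinuousConstSMul (group hD) (HC s n) where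
  continuous_const_smul γ := by
    obtain ⟨A, c, h⟩ := group_affine hD γ.1 γ.2
    refine Continuous.subtype_mk (f := fun p : HC s n => (γ.1 p).1) ?_ _
    simp_rw [h]
    fun_prop

/-- The monomials `∏ D i ^ m i`. -/
def mono (D : Fin s → ℤ[X]) (m : Fin s → ℕ) : ℤ[X] := ∏ i, D i ^ m i

theorem mono_add (m m' : Fin s → ℕ) : mono D (m + m') = mono D m * mono D m' := by
  simp [mono, pow_add, Finset.prod_mul_distrib]

theorem mono_zero : mono D 0 = 1 := by simp [mono]

theorem mono_single (i : Fin s) : mono D (Pi.single i 1) = D i := by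
  rw [mono, Finset.prod_eq_single i] <;> simp +contextual

theorem mono_det (hD : IsDirichletFamily M Λ.α D) (m : Fin s → ℕ) :
    (aeval M (mono D m)).det = 1 := by
  have h : ∀ t : Finset (Fin s), (aeval M (∏ i ∈ t, D i ^ m i)).det = 1 := by
    intro t
    induction t using Finset.induction_on with
    | empty => simp
    | insert i t hi ih =>
      rw [Finset.prod_insert hi, map_mul, Matrix.det_mul, ih, map_pow, Matrix.det_pow, hD.det]
      simp
  exact h Finset.univ

theorem mono_pos (hD : IsDirichletFamily M Λ.α D) (m : Fin s → ℕ) (j : Fin s) :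
    0 < aeval (Λ.α j) (mono D m) := by
  simp only [mono, map_prod, map_pow]
  exact Finset.prod_pos fun i _ => pow_pos (hD.pos i j) _

/-- Integer linear combinations of the `v k`. -/
def lat (Λ : SpectralData M s n) (l : Fin N → ℤ) : Model s n := Λ.lin fun k => (l k : ℝ)

theorem lat_add (l l' : Fin N → ℤ) : Λ.lat (l + l') = Λ.lat l + Λ.lat l' := by
  rw [lat, lat, lat, ← map_add]; congr 1; ext; simp

theorem lat_neg (l : Fin N → ℤ) : Λ.lat (-l) = - Λ.lat l := by
  rw [lat, lat, ← map_neg]; congr 1; ext; simp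

theorem lat_zero : Λ.lat 0 = 0 := by
  rw [lat, ← map_zero Λ.lin]; congr 1; ext; simp

theorem lat_single (k : Fin N) : Λ.lat (Pi.single k 1) = Λ.v k := by
  rw [lat, lin, Fintype.linearCombination_apply, Finset.sum_eq_single k] <;>
    simp +contextual

theorem op_lat (P : ℤ[X]) (l : Fin N → ℤ) :
    Λ.op P (Λ.lat l) = Λ.lat ((aeval M P)ᵀ *ᵥ l) := by
  rw [lat, op_lin, lat]; congr 1; ext i
  simp [Matrix.mulVec, dotProduct]

/-- A normal form for the elements of the group. -/
theorem group_normal (hD : IsDirichletFamily M Λ.α D) (γ : Equiv.Perm (HC s n))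
    (hγ : γ ∈ group hD) :
    ∃ (m m' : Fin s → ℕ) (l : Fin N → ℤ), ∀ p,
      Λ.op (mono D m') (γ p).1 = Λ.op (mono D m) p.1 + Λ.lat l := by
  induction hγ using Subgroup.closure_induction with
  | mem γ h =>
    rcases h with ⟨i, rfl⟩ | ⟨k, rfl⟩
    · exact ⟨Pi.single i 1, 0, 0, fun p => by
        rw [mono_zero, op_one, lat_zero, add_zero, mono_single, g_coe]⟩
    · exact ⟨0, 0, Pi.single k 1, fun p => by
        rw [mono_zero, op_one, op_one, lat_single, trans_coe]⟩
  | one => exact ⟨0, 0, 0, fun p => by simp [lat_zero]⟩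
  | mul γ γ' _ _ h h' =>
    obtain ⟨m, q, l, h⟩ := h
    obtain ⟨m', q', l', h'⟩ := h'
    refine ⟨m + m', q + q', (aeval M (mono D m))ᵀ *ᵥ l' + (aeval M (mono D q'))ᵀ *ᵥ l,
      fun p => ?_⟩
    rw [Equiv.Perm.mul_apply, mono_add, mono_add, op_mul, op_comm, h, map_add, op_comm, h', map_add,
      lat_add, ← op_lat, ← op_lat, op_mul, add_assoc]
  | inv γ _ h =>
    obtain ⟨m, q, l, h⟩ := h
    refine ⟨q, m, -l, fun p => ?_⟩
    have := h (γ⁻¹ p)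
    rw [show γ (γ⁻¹ p) = p from γ.apply_symm_apply p] at this
    rw [this, lat_neg]
    abel


theorem charpoly_derivative_ne (hM : IsTypeJ M) (x : ℝ) (hx : aeval x M.charpoly = 0) :
    aeval x (derivative M.charpoly) ≠ 0 := by
  obtain ⟨k, B, hB⟩ := hM
  have h0 := hx
  rw [hB.prod, map_prod, Finset.prod_eq_zero_iff] at h0
  obtain ⟨i, -, hi⟩ := h0
  have hi0 : i ≠ 0 := fun h => hB.noRealRoot x (h ▸ hi)
  have hdeg : (B i).natDegree ≠ 0 := by
    intro h
    rw [Polynomial.eq_C_of_natDegree_eq_zero h, aeval_C] at hi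
    have h2 : (B i).coeff 0 = 0 := by simpa using hi
    have h3 : B i = 0 := by rw [Polynomial.eq_C_of_natDegree_eq_zero h, h2, C_0]
    exact (hB.irred i hi0).ne_zero h3
  have hirr := (IsPrimitive.Int.irreducible_iff_irreducible_map_cast
    ((hB.irred i hi0).isPrimitive hdeg)).mp (hB.irred i hi0)
  have hd : aeval x (derivative (B i)) ≠ 0 := by
    have := hirr.separable.aeval_derivative_ne_zero (S := ℝ) (x := x) (by
      rw [← algebraMap_int_eq, aeval_map_algebraMap, hi])
    rwa [derivative_map, ← algebraMap_int_eq, aeval_map_algebraMap] at this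
  have hF : aeval x (∏ j ∈ Finset.univ.erase i, B j) ≠ 0 := by
    rw [map_prod, Finset.prod_ne_zero_iff]
    intro j hj h
    obtain ⟨u, w, huw⟩ := hB.coprime j i (Finset.ne_of_mem_erase hj)
    have := congrArg (aeval x) huw
    rw [map_add, map_mul, map_mul, h, hi] at this
    simp at this
  rw [hB.prod, ← Finset.mul_prod_erase _ _ (Finset.mem_univ i), derivative_mul, map_add, map_mul,
    map_mul, hi, zero_mul, add_zero]
  exact mul_ne_zero hd hF

theorem finrank_maxGen (M : Matrix (Fin N) (Fin N) ℤ) (μ : ℂ) :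
    Module.finrank ℂ (Module.End.maxGenEigenspace
      (Matrix.toLin' (M.map (Int.cast : ℤ → ℂ))) μ) =
      (M.charpoly.map (Int.castRingHom ℂ)).rootMultiplicity μ := by
  rw [LinearMap.finrank_maxGenEigenspace_eq, Matrix.charpoly_toLin', ← Matrix.charpoly_map]
  rfl

theorem conj_mulVec (y : Fin N → ℂ) :
    M.map (Int.cast : ℤ → ℂ) *ᵥ (fun i => starRingEnd ℂ (y i)) =
      fun i => starRingEnd ℂ ((M.map (Int.cast : ℤ → ℂ) *ᵥ y) i) := by
  ext i; simp [Matrix.mulVec, dotProduct]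

theorem conj_mem_maxGen (μ : ℂ) (y : Fin N → ℂ)
    (hy : y ∈ Module.End.maxGenEigenspace (Matrix.toLin' (M.map (Int.cast : ℤ → ℂ))) μ) :
    (fun i => starRingEnd ℂ (y i)) ∈
      Module.End.maxGenEigenspace (Matrix.toLin' (M.map (Int.cast : ℤ → ℂ)))
        (starRingEnd ℂ μ) := by
  set f : Module.End ℂ (Fin N → ℂ) := Matrix.toLin' (M.map (Int.cast : ℤ → ℂ)) with hf
  rw [Module.End.mem_maxGenEigenspace] at hy ⊢
  obtain ⟨k, hk⟩ := hy
  refine ⟨k, ?_⟩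
  have h : ∀ (k : ℕ) (y : Fin N → ℂ),
      ((f - starRingEnd ℂ μ • 1) ^ k : Module.End ℂ (Fin N → ℂ)) (fun i => starRingEnd ℂ (y i)) =
        fun i => starRingEnd ℂ (((f - μ • 1) ^ k : Module.End ℂ (Fin N → ℂ)) y i) := by
    intro k
    induction k with
    | zero => intro y; rfl
    | succ k ih =>
      intro y
      rw [pow_succ, pow_succ, Module.End.mul_apply, Module.End.mul_apply, ← ih]
      congr 1
      ext i
      simp only [LinearMap.sub_apply, hf, Matrix.toLin'_apply, conj_mulVec]
      simp
  rw [h, hk]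
  ext; simp

/-- The vectors `v k` are linearly independent over `ℝ`. -/
theorem lin_injective (hM : IsTypeJ M) (Λ : SpectralData M s n) : Function.Injective Λ.lin := by
  rw [← LinearMap.ker_eq_bot, LinearMap.ker_eq_bot']
  intro x hx
  set f := Matrix.toLin' (M.map (Int.cast : ℤ → ℂ)) with hf
  let φ : (Fin N → ℂ) →ₗ[ℂ] ℂ := Fintype.linearCombination ℂ (fun i => (x i : ℂ))
  have hφ : ∀ y, φ y = ∑ i, y i * x i := fun y => by
    simp [φ, Fintype.linearCombination_apply]
  have hne : M.charpoly.map (Int.castRingHom ℂ) ≠ 0 := (M.charpoly_monic.map _).ne_zero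
  have hroot : ∀ μ : ℂ, (M.charpoly.map (Int.castRingHom ℂ)).IsRoot μ ↔ aeval μ M.charpoly = 0 := by
    intro μ
    rw [IsRoot.def, ← algebraMap_int_eq, eval_map_algebraMap]
  have hS : ∀ μ ∈ Λ.S, Module.End.maxGenEigenspace f μ ≤ LinearMap.ker φ := by
    intro μ hμ y hy
    have hyW : y ∈ genEigenSum M Λ.S :=
      (le_iSup₂_of_le (f := fun β (_ : β ∈ Λ.S) => Module.End.maxGenEigenspace f β)
        μ hμ le_rfl) hy
    have hle : genEigenSum M Λ.S ≤ LinearMap.ker φ := by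
      have h1 : ∀ w : genEigenSum M Λ.S, φ.comp (genEigenSum M Λ.S).subtype w = 0 := by
        intro w
        have : φ.comp (genEigenSum M Λ.S).subtype = 0 := by
          refine Λ.b.ext fun j => ?_
          have := congrFun (congrArg Prod.snd hx) j
          rw [lin_snd] at this
          simpa [hφ, Matrix.mulVec, dotProduct, bMat] using this
        rw [this]; rfl
      intro w hw
      exact h1 ⟨w, hw⟩
    exact hle hyW
  have htop : (⊤ : Submodule ℂ (Fin N → ℂ)) ≤ LinearMap.ker φ := by
    rw [← Module.End.iSup_maxGenEigenspace_eq_top f]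
    refine iSup_le fun μ => ?_
    by_cases hr : aeval μ M.charpoly = 0
    · by_cases him : μ.im = 0
      · obtain ⟨t, rfl⟩ : ∃ t : ℝ, (t : ℂ) = μ := ⟨μ.re, Complex.ext (by simp) (by simp [him])⟩
        have ht : aeval t M.charpoly = 0 := by
          have : aeval ((algebraMap ℝ ℂ) t) M.charpoly = 0 := hr
          rw [aeval_algebraMap_apply] at this
          simpa using this
        obtain ⟨j, rfl⟩ := (Λ.α_roots.isRoot_iff t).mp ht
        have hm : Module.finrank ℂ (Module.End.maxGenEigenspace f (Λ.α j : ℂ)) ≤ 1 := by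
          rw [hf, finrank_maxGen]
          by_contra hlt
          push Not at hlt
          have h2 := ((one_lt_rootMultiplicity_iff_isRoot hne).mp hlt).2
          rw [derivative_map, IsRoot.def, ← algebraMap_int_eq, eval_map_algebraMap] at h2
          have h3 : aeval ((algebraMap ℝ ℂ) (Λ.α j)) (derivative M.charpoly) = 0 := h2
          rw [aeval_algebraMap_apply] at h3
          exact charpoly_derivative_ne hM _ ht (by simpa using h3)
        let w : Fin N → ℂ := fun i => (Λ.a j i : ℂ)
        have hw : w ∈ Module.End.maxGenEigenspace f (Λ.α j : ℂ) := by
          rw [Module.End.mem_maxGenEigenspace]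
          refine ⟨1, ?_⟩
          rw [pow_one, LinearMap.sub_apply, hf, Matrix.toLin'_apply, sub_eq_zero]
          ext i
          have := congrFun (Λ.a_eigen j) i
          simp only [Matrix.mulVec, dotProduct, Matrix.map_apply, Pi.smul_apply, smul_eq_mul] at this
          simp only [Matrix.mulVec, dotProduct, Matrix.map_apply, LinearMap.smul_apply,
            Module.End.one_apply, Pi.smul_apply, smul_eq_mul, w]
          exact_mod_cast congrArg (fun r : ℝ => (r : ℂ)) this
        have hw0 : w ≠ 0 := fun h => Λ.a_ne j (funext fun i => by
          have := congrFun h i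
          exact Complex.ofReal_eq_zero.mp this)
        intro y hy
        obtain ⟨c, hc⟩ := (finrank_le_one_iff.mp hm)
        obtain ⟨c1, h1⟩ := hc ⟨w, hw⟩
        obtain ⟨c2, h2⟩ := hc ⟨y, hy⟩
        have h1' : c1 • (c : Fin N → ℂ) = w := congrArg Subtype.val h1
        have h2' : c2 • (c : Fin N → ℂ) = y := congrArg Subtype.val h2
        have hφw : φ w = 0 := by
          have := congrFun (congrArg Prod.fst hx) j
          rw [lin_fst] at this
          rw [hφ]
          have h3 : x ⬝ᵥ Λ.a j = 0 := Complex.ofReal_eq_zero.mp this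
          have h4 : ∑ i, w i * x i = ((x ⬝ᵥ Λ.a j : ℝ) : ℂ) := by
            simp [dotProduct, w, mul_comm]
          rw [h4, h3, Complex.ofReal_zero]
        have hc1 : c1 ≠ 0 := by
          rintro rfl
          exact hw0 (by rw [← h1', zero_smul])
        rw [← h1', map_smul, smul_eq_mul] at hφw
        rw [LinearMap.mem_ker, ← h2', map_smul, (mul_eq_zero.mp hφw).resolve_left hc1, smul_zero]
      · by_cases hμ : μ ∈ Λ.S
        · exact hS μ hμ
        · have hc : starRingEnd ℂ μ ∈ Λ.S := by
            by_contra h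
            exact hμ ((Λ.S_half μ hr him).mpr h)
          intro y hy
          have h1 := hS _ hc (conj_mem_maxGen μ y hy)
          rw [LinearMap.mem_ker, hφ] at h1 ⊢
          have h2 := congrArg (starRingEnd ℂ) h1
          simpa using h2
    · have h0 : Module.finrank ℂ (Module.End.maxGenEigenspace f μ) = 0 := by
        rw [hf, finrank_maxGen, rootMultiplicity_eq_zero]
        rwa [hroot]
      rw [Submodule.finrank_eq_zero.mp h0]
      exact bot_le
  ext i
  have : φ (Pi.single i 1) = 0 := htop trivial
  rw [hφ, Finset.sum_eq_single i] at this
  · simpa using this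
  · intro j _ hj; simp [hj]
  · simp

/-- The lattice of translations is discrete. -/
theorem lat_discrete (hM : IsTypeJ M) (Λ : SpectralData M s n) :
    ∃ ε > 0, ∀ l : Fin N → ℤ, ‖Λ.lat l‖ < ε → l = 0 := by
  obtain ⟨K, hK, h⟩ := Λ.lin.exists_antilipschitzWith
    (LinearMap.ker_eq_bot.mpr (Λ.lin_injective hM))
  have hK' : (0 : ℝ) < K := by exact_mod_cast hK
  refine ⟨(K : ℝ)⁻¹, inv_pos.mpr hK', fun l hl => ?_⟩
  have h1 := h.le_mul_dist (fun k => (l k : ℝ)) 0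
  rw [map_zero, dist_zero_right, dist_zero_right] at h1
  have h2 : ‖fun k => (l k : ℝ)‖ < 1 := by
    refine h1.trans_lt ?_
    calc (K : ℝ) * ‖Λ.lat l‖ < K * (K : ℝ)⁻¹ := by gcongr
      _ = 1 := mul_inv_cancel₀ hK'.ne'
  ext k
  have h3 := (norm_le_pi_norm (fun k => (l k : ℝ)) k).trans_lt h2
  rw [Real.norm_eq_abs, ← Int.cast_abs] at h3
  have h4 : |l k| < 1 := by exact_mod_cast h3
  exact Int.abs_lt_one_iff.mp h4

/-- The lattice generated by the logarithms is discrete. -/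
theorem log_discrete (hD : IsDirichletFamily M Λ.α D) :
    ∃ ε > 0, ∀ l : Fin s → ℤ,
      ‖fun j => ∑ i, (l i : ℝ) * Real.log (aeval (Λ.α j) (D i))‖ < ε → l = 0 := by
  let L : (Fin s → ℝ) →ₗ[ℝ] (Fin s → ℝ) :=
    Fintype.linearCombination ℝ (fun i j => Real.log (aeval (Λ.α j) (D i)))
  have hL : ∀ l, L l = fun j => ∑ i, l i * Real.log (aeval (Λ.α j) (D i)) := fun l => by
    ext j; simp [L, Fintype.linearCombination_apply]
  have hinj : LinearMap.ker L = ⊥ := by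
    rw [LinearMap.ker_eq_bot]
    exact hD.logBasis.linInd.fintypeLinearCombination_injective
  obtain ⟨K, hK, h⟩ := L.exists_antilipschitzWith hinj
  have hK' : (0 : ℝ) < K := by exact_mod_cast hK
  refine ⟨(K : ℝ)⁻¹, inv_pos.mpr hK', fun l hl => ?_⟩
  rw [← hL fun i => (l i : ℝ)] at hl
  have h1 := h.le_mul_dist (fun k => (l k : ℝ)) 0
  rw [map_zero, dist_zero_right, dist_zero_right] at h1
  have h2 : ‖fun k => (l k : ℝ)‖ < 1 := by
    refine h1.trans_lt ?_
    calc (K : ℝ) * ‖L fun i => (l i : ℝ)‖ < K * (K : ℝ)⁻¹ := by gcongr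
      _ = 1 := mul_inv_cancel₀ hK'.ne'
  ext k
  have h3 := (norm_le_pi_norm (fun k => (l k : ℝ)) k).trans_lt h2
  rw [Real.norm_eq_abs, ← Int.cast_abs] at h3
  have h4 : |l k| < 1 := by exact_mod_cast h3
  exact Int.abs_lt_one_iff.mp h4

theorem log_mono (hD : IsDirichletFamily M Λ.α D) (m : Fin s → ℕ) (j : Fin s) :
    Real.log (aeval (Λ.α j) (mono D m)) = ∑ i, (m i : ℝ) * Real.log (aeval (Λ.α j) (D i)) := by
  rw [mono, map_prod, Real.log_prod fun i _ => by
    rw [map_pow]; exact (pow_pos (hD.pos i j) _).ne']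
  simp

/-- Coordinates in which the group acts on the imaginary parts by translations. -/
def logIm (p : HC s n) : Fin s → ℝ := fun j => Real.log ((p.1.1 j).im)

theorem continuous_logIm : Continuous (logIm : HC s n → Fin s → ℝ) := by
  refine continuous_pi fun j => Continuous.log ?_ fun p => (p.2 j).ne'
  exact Complex.continuous_im.comp ((continuous_apply j).comp
    (continuous_fst.comp continuous_subtype_val))

/-- Points of the same orbit which are close to each other coincide. -/
theorem eq_of_close (hM : IsTypeJ M) (hD : IsDirichletFamily M Λ.α D) :
    ∃ ε > 0, ∀ γ ∈ group hD, ∀ p : HC s n, dist (logIm (γ p)) (logIm p) < ε →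
      dist (γ p).1 p.1 < ε → γ p = p := by
  obtain ⟨ε₁, hε₁, h₁⟩ := Λ.lat_discrete hM
  obtain ⟨ε₂, hε₂, h₂⟩ := log_discrete hD
  refine ⟨min ε₁ ε₂, lt_min hε₁ hε₂, fun γ hγ p hlog hdist => ?_⟩
  obtain ⟨m, m', l, h⟩ := group_normal hD γ hγ
  have hp := h p
  have hm : m = m' := by
    have h0 := h₂ (fun i => (m i : ℤ) - m' i) (by
      refine lt_of_eq_of_lt ?_ (hlog.trans_le (min_le_right _ _))
      rw [dist_eq_norm]
      congr 1
      ext j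
      have h3 := congrArg Complex.im (congrFun (congrArg Prod.fst hp) j)
      rw [op_fst, Prod.fst_add, Pi.add_apply, op_fst, lat, lin_fst, Complex.add_im,
        Complex.im_ofReal_mul, Complex.im_ofReal_mul, Complex.ofReal_im, add_zero] at h3
      have h4 := congrArg Real.log h3
      rw [Real.log_mul (mono_pos hD _ _).ne' ((γ p).2 j).ne',
        Real.log_mul (mono_pos hD _ _).ne' (p.2 j).ne', log_mono hD, log_mono hD] at h4
      simp only [Pi.sub_apply, logIm]
      push_cast
      simp only [sub_mul, Finset.sum_sub_distrib]
      linarith)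
    ext i
    have := congrFun h0 i
    simp only [Pi.zero_apply] at this
    omega
  subst hm
  have hU : IsUnit ((aeval M (mono D m))ᵀ).det := by
    rw [Matrix.det_transpose, mono_det hD]; exact isUnit_one
  have hl : l = (aeval M (mono D m))ᵀ *ᵥ (((aeval M (mono D m))ᵀ)⁻¹ *ᵥ l) := by
    rw [Matrix.mulVec_mulVec, Matrix.mul_nonsing_inv _ hU, Matrix.one_mulVec]
  rw [hl, ← op_lat, ← map_add] at hp
  have h5 := Λ.op_injective _ (mono_det hD m) (mono_pos hD m) hp
  have h6 : ((aeval M (mono D m))ᵀ)⁻¹ *ᵥ l = 0 := by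
    apply h₁
    rw [dist_eq_norm, h5, add_sub_cancel_left] at hdist
    exact hdist.trans_le (min_le_left _ _)
  rw [h6, lat_zero, add_zero] at h5
  exact Subtype.ext h5

end SpectralData

open SpectralData

section Quotient

variable {N s n : ℕ} {M : Matrix (Fin N) (Fin N) ℤ} {Λ : SpectralData M s n} {D : Fin s → ℤ[X]}

/-- The space `T(M, 𝒟)`: the quotient of `ℍ^s × ℂ^n` by the group `G`. -/
def T (_hM : IsTypeJ M) (hD : IsDirichletFamily M Λ.α D) : Type :=
  MulAction.orbitRel.Quotient (group hD) (HC s n)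

instance (hM : IsTypeJ M) (hD : IsDirichletFamily M Λ.α D) : TopologicalSpace (T hM hD) :=
  inferInstanceAs (TopologicalSpace (Quotient (MulAction.orbitRel (group hD) (HC s n))))

/-- The projection `ℍ^s × ℂ^n → T(M, 𝒟)`. -/
def proj (hM : IsTypeJ M) (hD : IsDirichletFamily M Λ.α D) : HC s n → T hM hD :=
  Quotient.mk (MulAction.orbitRel (group hD) (HC s n))

theorem proj_isOpenQuotientMap (hM : IsTypeJ M) (hD : IsDirichletFamily M Λ.α D) :
    IsOpenQuotientMap (proj hM hD) :=
  MulAction.isOpenQuotientMap_quotientMk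

theorem proj_eq_iff (hM : IsTypeJ M) (hD : IsDirichletFamily M Λ.α D) (p q : HC s n) :
    proj hM hD p = proj hM hD q ↔ ∃ γ ∈ group hD, γ q = p := by
  refine Quotient.eq.trans ?_
  rw [MulAction.orbitRel_apply]
  constructor
  · rintro ⟨γ, h⟩; exact ⟨γ.1, γ.2, h⟩
  · rintro ⟨γ, hγ, h⟩; exact ⟨⟨γ, hγ⟩, h⟩

theorem proj_isLocalHomeomorph (hM : IsTypeJ M) (hD : IsDirichletFamily M Λ.α D) :
    IsLocalHomeomorph (proj hM hD) := by
  rw [isLocalHomeomorph_iff_isOpenEmbedding_restrict]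
  intro x
  obtain ⟨ε, hε, h⟩ := eq_of_close hM hD
  have hq := proj_isOpenQuotientMap hM hD
  let U : Set (HC s n) := {p | dist (logIm p) (logIm x) < ε / 2} ∩ {p | dist p.1 x.1 < ε / 2}
  have hU : IsOpen U :=
    (isOpen_lt (continuous_logIm.dist continuous_const) continuous_const).inter
      (isOpen_lt (continuous_subtype_val.dist continuous_const) continuous_const)
  refine ⟨U, hU.mem_nhds ⟨by simpa using half_pos hε, by simpa using half_pos hε⟩, ?_⟩
  refine Topology.IsOpenEmbedding.of_continuous_injective_isOpenMap ?_ ?_ ?_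
  · exact hq.continuous.comp continuous_subtype_val
  · rintro ⟨p, hp⟩ ⟨q, hq⟩ hpq
    obtain ⟨γ, hγ, rfl⟩ := (proj_eq_iff hM hD p q).mp hpq
    apply Subtype.ext
    refine h γ hγ q ?_ ?_
    · have := dist_triangle_right (logIm (γ q)) (logIm q) (logIm x)
      linarith [hp.1.out, hq.1.out]
    · have := dist_triangle_right (γ q).1 q.1 x.1
      linarith [hp.2.out, hq.2.out]
  · exact hq.isOpenMap.comp hU.isOpenMap_subtype_val

theorem isOpen_HC (s n : ℕ) : IsOpen {p : Model s n | ∀ j, 0 < (p.1 j).im} := by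
  have : {p : Model s n | ∀ j, 0 < (p.1 j).im} = ⋂ j, {p | 0 < (p.1 j).im} := by
    ext; simp
  rw [this]
  exact isOpen_iInter_of_finite fun j => isOpen_lt continuous_const
    (Complex.continuous_im.comp ((continuous_apply j).comp continuous_fst))

instance (s n : ℕ) : Nonempty (HC s n) := ⟨⟨(fun _ => Complex.I, 0), fun _ => by simp⟩⟩

/-- The inclusion of `ℍ^s × ℂ^n` in `ℂ^s × ℂ^n`. -/
def incl (s n : ℕ) : OpenPartialHomeomorph (HC s n) (Model s n) :=
  (isOpen_HC s n).isOpenEmbedding_subtypeVal.toOpenPartialHomeomorph Subtype.val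

theorem incl_apply (p : HC s n) : incl s n p = p.1 := rfl

/-- The chart of `T(M, 𝒟)` given by a local inverse of the projection near the point `x`. -/
def chart (hM : IsTypeJ M) (hD : IsDirichletFamily M Λ.α D) (x : HC s n) :
    OpenPartialHomeomorph (T hM hD) (Model s n) :=
  ((proj_isLocalHomeomorph hM hD).localInverseAt x).trans (incl s n)

/-- The charts of `T(M, 𝒟)` are the local inverses of the projection `ℍ^s × ℂ^n → T(M, 𝒟)`. -/
instance (hM : IsTypeJ M) (hD : IsDirichletFamily M Λ.α D) :
    ChartedSpace (Model s n) (T hM hD) where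
  atlas := Set.range (chart hM hD)
  chartAt q := chart hM hD (Function.surjInv (proj_isOpenQuotientMap hM hD).surjective q)
  mem_chart_source q := by
    have h := (proj_isLocalHomeomorph hM hD).apply_self_mem_localInverseAt_source
      (x := Function.surjInv (proj_isOpenQuotientMap hM hD).surjective q)
    rw [Function.surjInv_eq (proj_isOpenQuotientMap hM hD).surjective q] at h
    simpa [chart, incl] using h
  chart_mem_atlas q := Set.mem_range_self _

theorem chart_spec (hM : IsTypeJ M) (hD : IsDirichletFamily M Λ.α D) (x : HC s n)
    {y : Model s n} (hy : y ∈ (chart hM hD x).target) :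
    ∃ p : HC s n, p.1 = y ∧ (chart hM hD x).symm y = proj hM hD p := by
  have h1 : y ∈ (incl s n).target := hy.1
  refine ⟨(incl s n).symm y, (incl s n).right_inv h1, ?_⟩
  change ((proj_isLocalHomeomorph hM hD).localInverseAt x).symm ((incl s n).symm y) = _
  rw [IsLocalHomeomorph.localInverseAt_symm]

theorem chart_apply (hM : IsTypeJ M) (hD : IsDirichletFamily M Λ.α D) (x : HC s n)
    {q : T hM hD} (hq : q ∈ (chart hM hD x).source) :
    ∃ p : HC s n, p.1 = chart hM hD x q ∧ proj hM hD p = q :=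
  ⟨(proj_isLocalHomeomorph hM hD).localInverseAt x q, rfl,
    (proj_isLocalHomeomorph hM hD).apply_localInverseAt_of_mem hq.1⟩

/-- `T(M, 𝒟)` is a complex manifold. -/
instance (hM : IsTypeJ M) (hD : IsDirichletFamily M Λ.α D) :
    IsManifold (modelWithCornersSelf ℂ (Model s n)) ω (T hM hD) := by
  refine isManifold_of_contDiffOn _ _ _ ?_
  rintro _ _ ⟨x, rfl⟩ ⟨x', rfl⟩
  simp only [modelWithCornersSelf_coe, modelWithCornersSelf_coe_symm, Function.comp_id,
    Function.id_comp, Set.preimage_id, Set.range_id, Set.inter_univ]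
  intro y hy
  refine ContDiffAt.contDiffWithinAt ?_
  obtain ⟨p, hpy, hp⟩ := chart_spec hM hD x hy.1
  obtain ⟨q, hqy, hq⟩ := chart_apply hM hD x' hy.2
  obtain ⟨γ, hγ, hγp⟩ := (proj_eq_iff hM hD q p).mp (hq.trans hp)
  obtain ⟨A, c, hA⟩ := group_affine hD γ hγ
  have hcont : Continuous fun u : Model s n => A u + c := by fun_prop
  have hU : IsOpen ((chart hM hD x).target ∩ (fun u => A u + c) ⁻¹' (chart hM hD x').target) :=
    (chart hM hD x).open_target.inter ((chart hM hD x').open_target.preimage hcont)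
  have hyU : y ∈ (chart hM hD x).target ∩ (fun u => A u + c) ⁻¹' (chart hM hD x').target := by
    refine ⟨hy.1, ?_⟩
    change A y + c ∈ (chart hM hD x').target
    rw [← hpy, ← hA, hγp, hqy]
    exact (chart hM hD x').map_source hy.2
  have hsm : ContDiffAt ℂ ω (fun u : Model s n => A u + c) y :=
    (A.contDiff.add contDiff_const).contDiffAt
  refine hsm.congr_of_eventuallyEq ?_
  filter_upwards [hU.mem_nhds hyU] with u hu
  obtain ⟨p₁, hp₁, hp₁'⟩ := chart_spec hM hD x hu.1
  obtain ⟨q₁, hq₁, hq₁'⟩ := chart_spec hM hD x' hu.2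
  have hγq : γ p₁ = q₁ := Subtype.ext (by rw [hA, hp₁, hq₁])
  have h1 : (chart hM hD x').symm (A u + c) = (chart hM hD x).symm u := by
    rw [hp₁', hq₁']
    exact (proj_eq_iff hM hD q₁ p₁).mpr ⟨γ, hγ, hγq⟩
  change chart hM hD x' ((chart hM hD x).symm u) = A u + c
  rw [← h1]
  exact (chart hM hD x').right_inv hu.2

end Quotient

/-! ### Differential forms and locally conformally Kähler structures -/

section Forms

variable (E X : Type*) [NormedAddCommGroup E] [NormedSpace ℂ E] [NormedSpace ℝ E]
  [IsScalarTower ℝ ℂ E] [TopologicalSpace X] [ChartedSpace E X]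

/-- A smooth real differential form of degree `k` on a manifold `X` modelled on `E`: a family of
smooth forms `form e` on the images of the charts `e` of `X`, compatible with the changes of charts.
The values of `form e` outside the image of the chart `e` are irrelevant. -/
structure DiffForm (k : ℕ) where
  form : OpenPartialHomeomorph X E → E → E [⋀^Fin k]→L[ℝ] ℝ
  smooth : ∀ e ∈ atlas E X, ContDiffOn ℝ ∞ (form e) e.target
  compat : ∀ e ∈ atlas E X, ∀ e' ∈ atlas E X, ∀ y ∈ (e.symm.trans e').source,
    form e y = (form e' (e' (e.symm y))).compContinuousLinearMap
      (fderiv ℝ (fun u => e' (e.symm u)) y)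

variable {E X}

/-- A real 2-form `Ω` on a complex manifold is the fundamental form of a Hermitian metric: it is
invariant under multiplication by `i`, and `(u, v) ↦ Ω(u, i v)` is positive definite. -/
def IsHermitianForm (Ω : DiffForm E X 2) : Prop :=
  ∀ e ∈ atlas E X, ∀ y ∈ e.target,
    (∀ u v : E, Ω.form e y ![Complex.I • u, Complex.I • v] = Ω.form e y ![u, v]) ∧
    (∀ u : E, u ≠ 0 → 0 < Ω.form e y ![u, Complex.I • u])

/-- The form is closed. -/
def IsClosedForm {k : ℕ} (η : DiffForm E X k) : Prop :=
  ∀ e ∈ atlas E X, ∀ y ∈ e.target, extDeriv (η.form e) y = 0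

/-- The equation `dΩ = θ ∧ Ω` for a 2-form `Ω` and a 1-form `θ`. -/
def ExtDerivEqWedge (Ω : DiffForm E X 2) (θ : DiffForm E X 1) : Prop :=
  ∀ e ∈ atlas E X, ∀ y ∈ e.target, ∀ u v w : E,
    extDeriv (Ω.form e) y ![u, v, w] =
      θ.form e y ![u] * Ω.form e y ![v, w] - θ.form e y ![v] * Ω.form e y ![u, w]
        + θ.form e y ![w] * Ω.form e y ![u, v]

variable (E X)

/-- The complex manifold `X` admits a Kähler structure: a Hermitian metric whose fundamental form is
closed. -/
def AdmitsKahler : Prop :=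
  ∃ Ω : DiffForm E X 2, IsHermitianForm Ω ∧ IsClosedForm Ω

/-- The complex manifold `X` admits a locally conformally Kähler structure: a Hermitian metric whose
fundamental form `Ω` satisfies `dΩ = θ ∧ Ω` for some closed 1-form `θ`. -/
def AdmitsLCK : Prop :=
  ∃ (Ω : DiffForm E X 2) (θ : DiffForm E X 1),
    IsHermitianForm Ω ∧ IsClosedForm θ ∧ ExtDerivEqWedge Ω θ

end Forms

/-- A complex matrix is diagonalizable. -/
def IsDiagonalizable {m : ℕ} (A : Matrix (Fin m) (Fin m) ℂ) : Prop :=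
  ∃ (P : Matrix (Fin m) (Fin m) ℂ) (d : Fin m → ℂ), IsUnit P ∧ A * P = P * Matrix.diagonal d

end DirichletManifold

end

/-! Let `Ω`, `θ` be a locally conformally Kähler structure. On the convex set `ℍ^s × ℂ^n` the
pullback of `θ` is `df`, and each element of `G` changes `f` by an additive constant. On the
translations these constants form a homomorphism `ℤ^N → ℝ`. Conjugation by `g i` acts on the
translations through `D i (M)ᵀ`, so this homomorphism is a real vector fixed by every `D i (M)`.

A primary family has no such vector except `0` (`IsPrimaryDirichletFamily.eq_zero_of_fixed`). A
common fixed vector would give an eigenvalue `β` of `M` with `D i (β) = 1` for all `i`. If `β` is a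
root of `B 0`, then `β = 1`, but `B 0` has no real root. If `β` is a root of another `B j`,
irreducibility carries the equations `P j i = 1` from `β` to the real roots, which contradicts the
log-basis.

Hence `f` is periodic, and `e^{-f} Ω` is a closed, lattice-periodic, positive (1,1)-form that `g i`
multiplies by a constant `e^{-σ}`. Averaging it over the torus of lattice directions makes its
components on `0 × ℂ^n` constant on `ℍ^s × ℂ^n` (`average_const`). This uses that the real span of
the lattice contains `0 × ℂ^n` (`exists_lin_eq`). The average is therefore a single positive
definite Hermitian form on `ℂ^n`, of which `D i (Rᵀ)` is a similitude (a change of variables by the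
unimodular matrix `D i (M)ᵀ`).

A similitude has no Jordan block of size two (`eq_zero_of_similitude`). Up to transposition, `ℂ^N`
splits into the real eigenlines, `W` and the conjugate of `W`, so `D i (M)` is diagonalizable
(`isDiagonalizable_aeval`). A Kähler structure is the case `θ = 0`. -/

noncomputable section

namespace DirichletManifold

section

open MeasureTheory Topology

/-! ### Averages of periodic functions -/

/-- The half-open unit cube, a fundamental domain of `ℤ^N` in `ℝ^N`. -/
def cube (N : ℕ) : Set (Fin N → ℝ) := ZSpan.fundamentalDomain (Pi.basisFun ℝ (Fin N))

theorem isAddFundamentalDomain_cube (N : ℕ) :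
    IsAddFundamentalDomain (Submodule.span ℤ (Set.range (Pi.basisFun ℝ (Fin N)))).toAddSubgroup
      (cube N) volume :=
  ZSpan.isAddFundamentalDomain' _ _

theorem measurableSet_cube (N : ℕ) : MeasurableSet (cube N) :=
  ZSpan.fundamentalDomain_measurableSet _

theorem cube_subset (N : ℕ) : cube N ⊆ Set.Icc 0 1 := by
  intro x hx
  rw [cube, ZSpan.mem_fundamentalDomain] at hx
  exact ⟨fun i => by simpa using (hx i).1, fun i => by simpa using (hx i).2.le⟩

theorem volume_cube (N : ℕ) : volume (cube N) = 1 := by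
  rw [cube, ZSpan.fundamentalDomain_pi_basisFun, volume_pi_pi]
  simp

instance (N : ℕ) : IsProbabilityMeasure (volume.restrict (cube N)) :=
  ⟨by rw [Measure.restrict_apply_univ, volume_cube]⟩

/-- The embedding of `ℤ^N` in `ℝ^N`. -/
abbrev intVec {N : ℕ} (l : Fin N → ℤ) : Fin N → ℝ := fun k => (l k : ℝ)

theorem mem_span_basisFun {N : ℕ} (x : Fin N → ℝ) :
    x ∈ Submodule.span ℤ (Set.range (Pi.basisFun ℝ (Fin N))) ↔ ∃ l : Fin N → ℤ, intVec l = x := by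
  rw [Module.Basis.mem_span_iff_repr_mem]
  constructor
  · intro h
    choose l hl using h
    exact ⟨l, funext fun k => by simpa using hl k⟩
  · rintro ⟨l, rfl⟩ k
    exact ⟨l k, by simp⟩

instance (N : ℕ) :
    Countable (Submodule.span ℤ (Set.range (Pi.basisFun ℝ (Fin N)))).toAddSubgroup := by
  refine Set.Countable.to_subtype ((Set.countable_range (intVec (N := N))).mono fun x hx => ?_)
  exact (mem_span_basisFun x).mp hx

variable {N : ℕ} {φ : (Fin N → ℝ) → ℝ}

/-- A translate of the cube is again a fundamental domain of `ℤ^N`, and a periodic function has the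
same integral over any two of them. -/
theorem setIntegral_cube_add (hφ : ∀ (l : Fin N → ℤ) x, φ (intVec l + x) = φ x)
    (y : Fin N → ℝ) : ∫ x in cube N, φ (y + x) = ∫ x in cube N, φ x := by
  have h1 := (isAddFundamentalDomain_cube N).vadd_of_comm (G' := Fin N → ℝ) y
  rw [(isAddFundamentalDomain_cube N).setIntegral_eq h1 (f := φ)]
  · exact ((measurePreserving_vadd y volume).setIntegral_image_emb
      (measurableEmbedding_const_vadd y) φ (cube N)).symm
  · rintro ⟨g, hg⟩ x
    obtain ⟨l, rfl⟩ := (mem_span_basisFun g).mp hg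
    exact hφ l x

theorem intVec_mulVec (A : Matrix (Fin N) (Fin N) ℤ) (l : Fin N → ℤ) :
    A.map (Int.cast : ℤ → ℝ) *ᵥ intVec l = intVec (A *ᵥ l) := by
  ext i; simp [intVec, Matrix.mulVec, dotProduct]

theorem det_map_intCast (A : Matrix (Fin N) (Fin N) ℤ) :
    (A.map (Int.cast : ℤ → ℝ)).det = A.det :=
  ((Int.castRingHom ℝ).map_det A).symm

/-- An integer matrix of determinant one permutes `ℤ^N` and preserves volume, so it carries the cube
to another fundamental domain of the same lattice. -/
theorem setIntegral_cube_mulVec (hφ : ∀ (l : Fin N → ℤ) x, φ (intVec l + x) = φ x)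
    (A : Matrix (Fin N) (Fin N) ℤ) (hA : A.det = 1) :
    ∫ x in cube N, φ (A.map (Int.cast : ℤ → ℝ) *ᵥ x) = ∫ x in cube N, φ x := by
  have hdet : (A.map (Int.cast : ℤ → ℝ)).det = 1 := by rw [det_map_intCast, hA, Int.cast_one]
  have hu : IsUnit (A.map (Int.cast : ℤ → ℝ)).det := by rw [hdet]; exact isUnit_one
  let T : (Fin N → ℝ) ≃ₗ[ℝ] (Fin N → ℝ) := Matrix.toLinearEquiv' _
    ((Matrix.isUnit_iff_isUnit_det _).mpr hu).invertible
  have hT : ∀ x, T x = A.map (Int.cast : ℤ → ℝ) *ᵥ x := fun x => rfl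
  have hspan : Submodule.span ℤ (Set.range ((Pi.basisFun ℝ (Fin N)).map T)) =
      Submodule.span ℤ (Set.range (Pi.basisFun ℝ (Fin N))) := by
    rw [← ZSpan.map]
    ext x
    simp only [Submodule.mem_map, mem_span_basisFun, LinearEquiv.coe_coe,
      LinearEquiv.restrictScalars_apply, hT]
    constructor
    · rintro ⟨_, ⟨l, rfl⟩, rfl⟩
      exact ⟨A *ᵥ l, (intVec_mulVec A l).symm⟩
    · rintro ⟨l, rfl⟩
      refine ⟨_, ⟨A⁻¹ *ᵥ l, rfl⟩, ?_⟩
      rw [intVec_mulVec, Matrix.mulVec_mulVec, Matrix.mul_nonsing_inv _ (by rw [hA]; exact isUnit_one),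
        Matrix.one_mulVec]
  have h1 := ZSpan.isAddFundamentalDomain' ((Pi.basisFun ℝ (Fin N)).map T) volume
  rw [hspan, ← ZSpan.map_fundamentalDomain] at h1
  rw [(isAddFundamentalDomain_cube N).setIntegral_eq h1 (f := φ)]
  · have hmp : MeasurePreserving T volume volume := by
      refine ⟨T.toContinuousLinearEquiv.continuous.measurable, ?_⟩
      have := Real.map_matrix_volume_pi_eq_smul_volume_pi (M := A.map (Int.cast : ℤ → ℝ))
        (by rw [hdet]; exact one_ne_zero)
      rw [hdet] at this
      simp only [inv_one, abs_one, ENNReal.ofReal_one, one_smul] at this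
      exact this
    exact (hmp.setIntegral_image_emb
      T.toContinuousLinearEquiv.toHomeomorph.measurableEmbedding φ (cube N)).symm
  · rintro ⟨g, hg⟩ x
    obtain ⟨l, rfl⟩ := (mem_span_basisFun g).mp hg
    exact hφ l x

theorem integrableOn_cube {F : Type*} [NormedAddCommGroup F]
    {φ : (Fin N → ℝ) → F} (hφ : Continuous φ) : IntegrableOn φ (cube N) :=
  (hφ.continuousOn.integrableOn_compact isCompact_Icc).mono_set (cube_subset N)

/-- Differentiation under the integral sign. -/
theorem hasFDerivAt_integral_cube {E : Type*} [NormedAddCommGroup E] [NormedSpace ℝ E]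
    [ProperSpace E] {U : Set E} (hU : IsOpen U) {G : E → ℝ} {G' : E → E →L[ℝ] ℝ}
    (hG : ∀ y ∈ U, HasFDerivAt G (G' y) y) (hG' : ContinuousOn G' U)
    (L : (Fin N → ℝ) →L[ℝ] E) (hL : ∀ y ∈ U, ∀ x, y + L x ∈ U) {y : E} (hy : y ∈ U) :
    HasFDerivAt (fun y => ∫ x in cube N, G (y + L x)) (∫ x in cube N, G' (y + L x)) y := by
  obtain ⟨ε, hε, hball⟩ := Metric.nhds_basis_closedBall.mem_iff.mp (hU.mem_nhds hy)
  have hGc : ContinuousOn G U := fun y hy => (hG y hy).continuousAt.continuousWithinAt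
  have hcont : ∀ y ∈ U, Continuous fun x => G (y + L x) := fun y hy =>
    hGc.comp_continuous (by fun_prop) (hL y hy)
  have hcont' : ∀ y ∈ U, Continuous fun x => G' (y + L x) := fun y hy =>
    hG'.comp_continuous (by fun_prop) (hL y hy)
  -- The cube is only half-open, so the dominating constant is taken on the closed cube times a
  -- closed ball, compact because `E` is proper.
  obtain ⟨C, hC⟩ := ((isCompact_closedBall y ε).prod
    (isCompact_Icc (a := (0 : Fin N → ℝ)) (b := 1))).exists_bound_of_continuousOn
      (f := fun p => G' (p.1 + L p.2))
      (hG'.comp (Continuous.continuousOn (by fun_prop)) fun p hp => hL _ (hball hp.1) _)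
  refine hasFDerivAt_integral_of_dominated_of_fderiv_le (bound := fun _ => C)
    (F' := fun y x => G' (y + L x))
    (Metric.closedBall_mem_nhds y hε) ?_ (integrableOn_cube (hcont y hy))
    (hcont' y hy).aestronglyMeasurable ?_ (integrable_const C) ?_
  · filter_upwards [hU.mem_nhds hy] with z hz using (hcont z hz).aestronglyMeasurable
  · filter_upwards [ae_restrict_mem (measurableSet_cube N)] with x hx z hz
    exact hC (z, x) ⟨hz, cube_subset N hx⟩
  · refine Filter.Eventually.of_forall fun x z hz => ?_
    have := hG _ (hL z (hball hz) x)
    exact (hasFDerivAt_comp_add_right (L x)).mpr this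

end

/-! ### Diagonalizability -/

/-- A complex matrix without generalized eigenvectors of rank two is diagonalizable. -/
theorem isDiagonalizable_of_ker {m : ℕ} (A : Matrix (Fin m) (Fin m) ℂ)
    (h : ∀ (μ : ℂ) (x y : Fin m → ℂ), A *ᵥ x = μ • x + y → A *ᵥ y = μ • y → y = 0) :
    IsDiagonalizable A := by
  set f : Module.End ℂ (Fin m → ℂ) := Matrix.toLin' A with hf
  -- By induction `(f - μ) x` satisfies the eigenvector equation, so `x` and `(f - μ) x` form a
  -- chain of length two, and `h` kills its second member.
  have hgen : ∀ (μ : ℂ) (k : ℕ) (x : Fin m → ℂ), ((f - μ • 1) ^ k : Module.End ℂ (Fin m → ℂ)) x = 0 →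
      f x = μ • x := by
    intro μ k
    induction k with
    | zero => intro x hx; simp only [pow_zero, Module.End.one_apply] at hx; simp [hx]
    | succ k ih =>
      intro x hx
      rw [pow_succ, Module.End.mul_apply] at hx
      have h1 := ih _ hx
      have h2 := h μ x ((f - μ • 1) x) (by
        simp only [LinearMap.sub_apply, hf, Matrix.toLin'_apply, LinearMap.smul_apply,
          Module.End.one_apply]
        abel) (by rw [← Matrix.toLin'_apply, ← hf, h1])
      simpa [sub_eq_zero] using h2
  have htop : ⨆ μ, Module.End.eigenspace f μ = ⊤ := by
    rw [eq_top_iff, ← Module.End.iSup_maxGenEigenspace_eq_top f]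
    refine iSup_mono fun μ x hx => ?_
    obtain ⟨k, hk⟩ := (Module.End.mem_maxGenEigenspace f μ x).mp hx
    exact Module.End.mem_eigenspace_iff.mpr (hgen μ k x hk)
  have hspan : ⊤ ≤ Submodule.span ℂ {x : Fin m → ℂ | ∃ μ : ℂ, f x = μ • x} := by
    rw [← htop]
    exact iSup_le fun μ x hx => Submodule.subset_span ⟨μ, Module.End.mem_eigenspace_iff.mp hx⟩
  let b := Module.Basis.ofSpan hspan
  have hb : ∀ i, ∃ μ : ℂ, f (b i) = μ • b i := fun i =>
    (Module.Basis.ofSpan_subset hspan) (Set.mem_range_self i)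
  let e := b.indexEquiv (Pi.basisFun ℂ (Fin m))
  let b' := b.reindex e
  have hb' : ∀ i, ∃ μ : ℂ, f (b' i) = μ • b' i := fun i => by
    rw [Module.Basis.reindex_apply]; exact hb _
  choose d hd using hb'
  refine ⟨Matrix.of fun i j => b' j i, d, ?_, ?_⟩
  · have : (Matrix.of fun i j => b' j i) = (Pi.basisFun ℂ (Fin m)).toMatrix b' := by
      ext i j; simp [Module.Basis.toMatrix_apply]
    rw [this]
    have := (Pi.basisFun ℂ (Fin m)).invertibleToMatrix b'
    exact isUnit_of_invertible _
  · ext i j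
    have := congrFun (hd j) i
    rw [hf, Matrix.toLin'_apply] at this
    rw [Matrix.mul_diagonal, mul_comm, Matrix.of_apply]
    exact this

theorem IsDiagonalizable.transpose {m : ℕ} {A : Matrix (Fin m) (Fin m) ℂ}
    (h : IsDiagonalizable A) : IsDiagonalizable Aᵀ := by
  obtain ⟨P, d, hP, h⟩ := h
  have hdet := (Matrix.isUnit_iff_isUnit_det P).mp hP
  have hdt : IsUnit Pᵀ.det := by rwa [Matrix.det_transpose]
  refine ⟨(Pᵀ)⁻¹, d, ?_, ?_⟩
  · rw [Matrix.isUnit_iff_isUnit_det]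
    exact Matrix.isUnit_nonsing_inv_det _ hdt
  · have h1 : Pᵀ * Aᵀ = Matrix.diagonal d * Pᵀ := by
      rw [← Matrix.transpose_mul, h, Matrix.transpose_mul, Matrix.diagonal_transpose]
    calc Aᵀ * (Pᵀ)⁻¹ = (Pᵀ)⁻¹ * (Pᵀ * Aᵀ) * (Pᵀ)⁻¹ := by
          rw [← Matrix.mul_assoc, Matrix.nonsing_inv_mul _ hdt, Matrix.one_mul]
      _ = (Pᵀ)⁻¹ * Matrix.diagonal d := by
          rw [h1, ← Matrix.mul_assoc, Matrix.mul_assoc _ _ (Pᵀ)⁻¹, Matrix.mul_nonsing_inv _ hdt,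
            Matrix.mul_one]

/-- A similitude of a positive definite Hermitian form has no generalized eigenvectors of rank
two. The form is given by its imaginary part `H`. -/
theorem eq_zero_of_similitude {V : Type*} [AddCommGroup V] [Module ℂ V] (H : V → V → ℝ)
    (hadd : ∀ u v w, H (u + v) w = H u w + H v w)
    (hadd' : ∀ u v w, H u (v + w) = H u v + H u w)
    (hsmul : ∀ (c : ℝ) u v, H ((c : ℂ) • u) v = c * H u v)
    (hsmul' : ∀ (c : ℝ) u v, H u ((c : ℂ) • v) = c * H u v)
    (hself : ∀ u, H u u = 0)
    (hI : ∀ u v, H (Complex.I • u) (Complex.I • v) = H u v)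
    (hpos : ∀ u, u ≠ 0 → 0 < H u (Complex.I • u))
    (Q : V →ₗ[ℂ] V) {c : ℝ} (hc : 0 < c) (hQ : ∀ u v, H (Q u) (Q v) = c * H u v)
    {μ : ℂ} {x y : V} (hx : Q x = μ • x + y) (hy : Q y = μ • y) : y = 0 := by
  by_contra hne
  have hp := hpos y hne
  have hII : ∀ u v, H u (Complex.I • v) = - H (Complex.I • u) v := fun u v => by
    have := hI (Complex.I • u) v
    rw [smul_smul, Complex.I_mul_I, show (-1 : ℂ) = ((-1 : ℝ) : ℂ) by simp, hsmul] at this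
    linarith
  have hμ : ∀ (μ : ℂ) (u v : V), H (μ • u) (μ • v) = Complex.normSq μ * H u v := by
    intro μ u v
    have h1 : ∀ w : V, μ • w = (μ.re : ℂ) • w + (μ.im : ℂ) • Complex.I • w := fun w => by
      rw [smul_smul, ← add_smul, Complex.re_add_im]
    rw [h1, h1, hadd, hadd', hadd', hsmul, hsmul, hsmul, hsmul, hsmul', hsmul', hsmul', hsmul',
      hI, hII, Complex.normSq_apply]
    ring
  have hleft : ∀ (μ : ℂ) (u v : V), H u (μ • v) = μ.re * H u v + μ.im * H u (Complex.I • v) := by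
    intro μ u v
    have h1 : μ • v = (μ.re : ℂ) • v + (μ.im : ℂ) • Complex.I • v := by
      rw [smul_smul, ← add_smul, Complex.re_add_im]
    rw [h1, hadd', hsmul', hsmul']
  -- Evaluating the similitude on the eigenvector `y` gives `|μ|² = c`.
  have e0 := hQ y (Complex.I • y)
  rw [hy, map_smul, hy, smul_comm, hμ] at e0
  have hn : Complex.normSq μ = c := mul_right_cancel₀ hp.ne' e0
  -- In `H (Q x) (Q y)` the term `|μ|² H x y` cancels against `c H x y`, leaving `H y (μ y) = 0`.
  -- The same computation with `i y` gives `H y (μ i y) = 0`. Together they force `μ = 0`, against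
  -- `|μ|² = c > 0`.
  have e1 := hQ x y
  rw [hx, hy, hadd, hμ, hn, hleft, hself] at e1
  have e2 := hQ x (Complex.I • y)
  rw [hx, map_smul, hy, smul_comm, hadd, hμ, hn, hleft μ, smul_smul, Complex.I_mul_I,
    show (-1 : ℂ) = ((-1 : ℝ) : ℂ) by simp, hsmul', hself] at e2
  have h1 : μ.im = 0 := by
    have : μ.im * H y (Complex.I • y) = 0 := by linarith
    exact (mul_eq_zero.mp this).resolve_right hp.ne'
  have h2 : μ.re = 0 := by
    have : μ.re * H y (Complex.I • y) = 0 := by linarith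
    exact (mul_eq_zero.mp this).resolve_right hp.ne'
  rw [Complex.normSq_apply, h1, h2] at hn
  simp at hn
  exact hc.ne hn

/-! ### Reduction of the diagonalizability of `P(M)` to that of `P(Rᵀ)` -/

namespace SpectralData

variable {N s n : ℕ} {M : Matrix (Fin N) (Fin N) ℤ}

theorem bMat_mulVec_aeval (Λ : SpectralData M s n) (P : ℤ[X]) (x : Fin N → ℂ) :
    Λ.bMatᵀ *ᵥ (((aeval M P).map (Int.cast : ℤ → ℂ))ᵀ *ᵥ x) =
      aeval Λ.Rᵀ P *ᵥ (Λ.bMatᵀ *ᵥ x) := by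
  rw [aeval_transpose, Matrix.mulVec_mulVec, Matrix.mulVec_mulVec, ← Matrix.transpose_mul,
    ← Matrix.transpose_mul, ← aeval_mul_bMat, aeval_map_cast]

theorem conj_aeval_mulVec (P : ℤ[X]) (x : Fin N → ℂ) :
    ((aeval M P).map (Int.cast : ℤ → ℂ))ᵀ *ᵥ star x =
      star (((aeval M P).map (Int.cast : ℤ → ℂ))ᵀ *ᵥ x) := by
  ext i; simp [Matrix.mulVec, dotProduct]

/-- The lattice vectors span: a complex vector orthogonal to all the eigenvectors vanishes. -/
theorem eq_zero_of_orthogonal (hM : IsTypeJ M) (Λ : SpectralData M s n) (y : Fin N → ℂ)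
    (ha : ∀ j, y ⬝ᵥ (fun i => (Λ.a j i : ℂ)) = 0) (hb : Λ.bMatᵀ *ᵥ y = 0)
    (hb' : Λ.bMatᵀ *ᵥ star y = 0) : y = 0 := by
  -- For real vectors this is the injectivity of `lin`. It is applied to the real and imaginary
  -- parts of `y`, which mix `y` and `star y`; hence the need for both `hb` and `hb'`.
  have key : ∀ x : Fin N → ℝ, (∀ j, ((x ⬝ᵥ Λ.a j : ℝ) : ℂ) = 0) →
      Λ.bMatᵀ *ᵥ (fun i => (x i : ℂ)) = 0 → x = 0 := fun x h1 h2 =>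
    Λ.lin_injective hM (by
      rw [map_zero]
      exact Prod.ext (funext fun j => by rw [lin_fst, h1]; rfl) (by rw [lin_snd, h2]; rfl))
  have hre := key (fun i => (y i).re) (fun j => by
      have := congrArg Complex.re (ha j)
      rw [Complex.ofReal_eq_zero, ← Complex.zero_re, ← this]
      simp [dotProduct]) (by
      have : (fun i => (((y i).re : ℝ) : ℂ)) = (2⁻¹ : ℂ) • (y + star y) := by
        ext i; simp [Complex.add_conj]
      rw [this, Matrix.mulVec_smul, Matrix.mulVec_add, hb, hb', add_zero, smul_zero])
  have him := key (fun i => (y i).im) (fun j => by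
      have := congrArg Complex.im (ha j)
      rw [Complex.ofReal_eq_zero, ← Complex.zero_im, ← this]
      simp [dotProduct]) (by
      have : (fun i => (((y i).im : ℝ) : ℂ)) = (2 * Complex.I)⁻¹ • (y - star y) := by
        ext i
        simp only [Pi.smul_apply, Pi.sub_apply, Pi.star_apply, RCLike.star_def, Complex.sub_conj,
          smul_eq_mul]
        push_cast
        field_simp
      rw [this, Matrix.mulVec_smul, Matrix.mulVec_sub, hb, hb', sub_zero, smul_zero])
  ext i
  exact Complex.ext (congrFun hre i) (congrFun him i)

/-- If `P(Rᵀ)` has no generalized eigenvectors of rank two, then `P(M)` is diagonalizable. -/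
theorem isDiagonalizable_aeval (hM : IsTypeJ M) (Λ : SpectralData M s n) (P : ℤ[X])
    (h : ∀ (μ : ℂ) (x y : Fin n → ℂ), aeval Λ.Rᵀ P *ᵥ x = μ • x + y →
      aeval Λ.Rᵀ P *ᵥ y = μ • y → y = 0) :
    IsDiagonalizable ((aeval M P).map (Int.cast : ℤ → ℂ)) := by
  -- The transpose is the natural operator here: `bMatᵀ` intertwines `P(M)ᵀ` with `P(Rᵀ)`. A chain
  -- of length two for `P(M)ᵀ` is tested against `W`, its conjugate and the real eigenvectors.
  rw [← Matrix.transpose_transpose ((aeval M P).map (Int.cast : ℤ → ℂ))]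
  refine (isDiagonalizable_of_ker _ fun μ x y hx hy => ?_).transpose
  have hb : ∀ (μ : ℂ) (x y : Fin N → ℂ),
      ((aeval M P).map (Int.cast : ℤ → ℂ))ᵀ *ᵥ x = μ • x + y →
      ((aeval M P).map (Int.cast : ℤ → ℂ))ᵀ *ᵥ y = μ • y → Λ.bMatᵀ *ᵥ y = 0 := by
    intro μ x y hx hy
    refine h μ (Λ.bMatᵀ *ᵥ x) (Λ.bMatᵀ *ᵥ y) ?_ ?_
    · rw [← bMat_mulVec_aeval, hx, Matrix.mulVec_add, Matrix.mulVec_smul]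
    · rw [← bMat_mulVec_aeval, hy, Matrix.mulVec_smul]
  refine Λ.eq_zero_of_orthogonal hM y (fun j => ?_) (hb μ x y hx hy)
    (hb (star μ) (star x) (star y) ?_ ?_)
  · have hA : ∀ z : Fin N → ℂ, (((aeval M P).map (Int.cast : ℤ → ℂ))ᵀ *ᵥ z) ⬝ᵥ
        (fun i => (Λ.a j i : ℂ)) = (aeval (Λ.α j) P : ℝ) * (z ⬝ᵥ fun i => (Λ.a j i : ℂ)) := by
      intro z
      have h1 : (aeval M P).map (Int.cast : ℤ → ℂ) *ᵥ (fun i => (Λ.a j i : ℂ)) =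
          ((aeval (Λ.α j) P : ℝ) : ℂ) • fun i => (Λ.a j i : ℂ) := by
        have h2 := Λ.aeval_mulVec_a P j
        rw [aeval_map_cast] at h2
        ext i
        have h3 := congrArg (fun r : ℝ => (r : ℂ)) (congrFun h2 i)
        simpa [Matrix.mulVec, dotProduct] using h3
      rw [Matrix.mulVec_transpose, ← Matrix.dotProduct_mulVec, h1, dotProduct_smul, smul_eq_mul]
    have h1 := hA x
    have h2 := hA y
    rw [hx, add_dotProduct, smul_dotProduct, smul_eq_mul] at h1
    rw [hy, smul_dotProduct, smul_eq_mul] at h2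
    -- Pairing with a real eigenvector reduces the chain to scalars: either `y` pairs to zero, or `μ
    -- = P(α j)`, and then the equation for `x` gives the same conclusion.
    have h4 : (((aeval (Λ.α j) P : ℝ) : ℂ) - μ) * (y ⬝ᵥ fun i => (Λ.a j i : ℂ)) = 0 := by
      linear_combination -h2
    rcases mul_eq_zero.mp h4 with h5 | h5
    · linear_combination h1 + h5 * (x ⬝ᵥ fun i => (Λ.a j i : ℂ))
    · exact h5
  · rw [conj_aeval_mulVec, hx, star_add, star_smul]
  · rw [conj_aeval_mulVec, hy, star_smul]

end SpectralData

/-! ### The real span of the lattice -/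

namespace SpectralData

variable {N s n : ℕ} {M : Matrix (Fin N) (Fin N) ℤ}

/-- Conjugation exchanges the generalized eigenspaces of `β` and its conjugate, and `S` contains
only one of the two. -/
theorem star_mem_genEigenSum (Λ : SpectralData M s n) {w : Fin N → ℂ}
    (hw : w ∈ genEigenSum M Λ.S) : star w ∈ genEigenSum M Λ.Sᶜ := by
  have h : genEigenSum M Λ.S ≤
      (genEigenSum M Λ.Sᶜ).comap (starLinearEquiv ℂ (A := Fin N → ℂ)).toLinearMap := by
    refine iSup₂_le fun β hβ x hx => ?_
    have h1 := conj_mem_maxGen β x hx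
    obtain ⟨h2, h3⟩ := Λ.S_root β hβ
    exact (le_iSup₂_of_le (f := fun β (_ : β ∈ Λ.Sᶜ) => Module.End.maxGenEigenspace _ β)
      (starRingEnd ℂ β) ((Λ.S_half β h2 h3).mp hβ) le_rfl) h1
  exact h hw

theorem ofReal_a_mem_genEigenSum (Λ : SpectralData M s n) (j : Fin s) :
    (fun i => (Λ.a j i : ℂ)) ∈ genEigenSum M Λ.Sᶜ := by
  have h1 : (fun i => (Λ.a j i : ℂ)) ∈ Module.End.maxGenEigenspace
      (Matrix.toLin' (M.map (Int.cast : ℤ → ℂ))) (Λ.α j : ℂ) := by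
    rw [Module.End.mem_maxGenEigenspace]
    refine ⟨1, ?_⟩
    rw [pow_one, LinearMap.sub_apply, Matrix.toLin'_apply, sub_eq_zero]
    ext i
    have := congrArg (fun r : ℝ => (r : ℂ)) (congrFun (Λ.a_eigen j) i)
    simpa [Matrix.mulVec, dotProduct] using this
  have h2 : (Λ.α j : ℂ) ∈ Λ.Sᶜ := fun h => (Λ.S_root _ h).2 (Complex.ofReal_im _)
  exact (le_iSup₂_of_le (f := fun β (_ : β ∈ Λ.Sᶜ) => Module.End.maxGenEigenspace _ β)
    _ h2 le_rfl) h1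

theorem disjoint_genEigenSum_compl (Λ : SpectralData M s n) :
    Disjoint (genEigenSum M Λ.S) (genEigenSum M Λ.Sᶜ) := by
  exact (Module.End.independent_maxGenEigenspace _).disjoint_biSup_biSup disjoint_compl_right

/-- The real span of the lattice contains `0 × ℂ^n`. -/
theorem exists_lin_eq (Λ : SpectralData M s n) (z : Fin n → ℂ) :
    ∃ x, Λ.lin x = (0, z) := by
  -- Duality replaces a dimension count: a real functional `ψ` vanishing on the lattice vectors is
  -- shown to vanish on `0 × ℂ^n`.
  by_contra hz
  obtain ⟨ψ, hψ, hker⟩ := Submodule.exists_le_ker_of_notMem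
    (p := LinearMap.range Λ.lin) (v := ((0, z) : Model s n)) hz
  have hv : ∀ i, ψ (Λ.v i) = 0 := fun i => hker ⟨Pi.single i 1, by
    rw [lin, Fintype.linearCombination_apply_single, one_smul]⟩
  -- The coefficients of the complex linear functional on `ℂ^n` whose real part is `ψ`.
  let d : Fin n → ℂ := fun k =>
    (ψ (0, Pi.single k 1) : ℂ) - ψ (0, Pi.single k Complex.I) * Complex.I
  have hd : ∀ y : Fin n → ℂ, ψ (0, y) = (∑ k, d k * y k).re := by
    intro y
    have hy : ((0, y) : Model s n) = ∑ k, ((y k).re • ((0, Pi.single k 1) : Model s n) +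
        (y k).im • ((0, Pi.single k Complex.I) : Model s n)) := by
      refine Prod.ext ?_ ?_
      · simp [Prod.fst_sum]
      · ext k
        simp only [Prod.snd_sum, Prod.snd_add, Prod.smul_snd, Finset.sum_apply, Pi.add_apply,
          Pi.smul_apply, Pi.single_apply]
        simp [Finset.sum_add_distrib, Complex.re_add_im]
    rw [hy, map_sum, Complex.re_sum]
    refine Finset.sum_congr rfl fun k _ => ?_
    simp only [map_add, map_smul, smul_eq_mul, d]
    simp
    ring
  have hc : ∀ y : Fin s → ℝ, ψ ((fun j => (y j : ℂ)), 0) = ∑ j, y j * ψ (Pi.single j 1, 0) := by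
    intro y
    have hy : (((fun j => (y j : ℂ)), 0) : Model s n) =
        ∑ j, y j • ((Pi.single j 1, 0) : Model s n) := by
      refine Prod.ext ?_ ?_
      · ext j
        simp [Prod.fst_sum, Finset.sum_apply, Pi.single_apply]
      · simp [Prod.snd_sum]
    rw [hy, map_sum]
    exact Finset.sum_congr rfl fun j _ => by rw [map_smul, smul_eq_mul]
  let w : genEigenSum M Λ.S := ∑ k, d k • Λ.b k
  have hw : ∀ i, (w : Fin N → ℂ) i = ∑ k, d k * (Λ.b k : Fin N → ℂ) i := fun i => by
    simp [w]
  -- The equations `ψ (v i) = 0` say that the real part of `w` is a combination of the `a j`. Thus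
  -- `w`, which lies in `W`, also lies in the sum of the generalized eigenspaces for eigenvalues
  -- outside `S`, and must vanish.
  have hsum : (w : Fin N → ℂ) = -(star (w : Fin N → ℂ) +
      ∑ j, ((2 * ψ (Pi.single j 1, 0) : ℝ) : ℂ) • fun i => (Λ.a j i : ℂ)) := by
    ext i
    have h1 := hv i
    have h2 : Λ.v i = ((fun j => (Λ.a j i : ℂ)), 0) + (0, fun k => (Λ.b k : Fin N → ℂ) i) := by
      simp [v]
    rw [h2, map_add, hc fun j => Λ.a j i, hd, ← hw] at h1
    have h3 := Complex.add_conj ((w : Fin N → ℂ) i)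
    have h4 : (((w : Fin N → ℂ) i).re : ℂ) = -∑ j, (Λ.a j i : ℂ) * ψ (Pi.single j 1, 0) := by
      have : ((w : Fin N → ℂ) i).re = -∑ j, Λ.a j i * ψ (Pi.single j 1, 0) := by linarith
      rw [this]; push_cast; rfl
    simp only [Pi.neg_apply, Pi.add_apply, Pi.star_apply, RCLike.star_def, Finset.sum_apply,
      Pi.smul_apply, smul_eq_mul]
    have h5 : ∑ j, ((2 * ψ (Pi.single j 1, 0) : ℝ) : ℂ) * (Λ.a j i : ℂ) =
        2 * ∑ j, (Λ.a j i : ℂ) * ψ (Pi.single j 1, 0) := by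
      rw [Finset.mul_sum]
      exact Finset.sum_congr rfl fun j _ => by push_cast; ring
    rw [h5]
    push_cast at h3
    linear_combination h3 + 2 * h4
  have hw0 : w = 0 := by
    refine Subtype.ext ?_
    refine Submodule.disjoint_def.mp Λ.disjoint_genEigenSum_compl _ w.2 ?_
    rw [hsum]
    exact Submodule.neg_mem _ (Submodule.add_mem _ (Λ.star_mem_genEigenSum w.2)
      (Submodule.sum_mem _ fun j _ => Submodule.smul_mem _ _ (Λ.ofReal_a_mem_genEigenSum j)))
  have hd0 : ∀ k, d k = 0 := Fintype.linearIndependent_iff.mp Λ.b.linearIndependent d hw0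
  exact hψ (by rw [hd]; simp [hd0])

end SpectralData

/-! ### Common fixed vectors of the matrices of a primary Dirichlet family -/

/-- Otherwise all the logarithm vectors would lie in a coordinate hyperplane. -/
theorem IsLogBasis.exists_ne_one {s : ℕ} {ξ : Fin s → Fin s → ℝ} (h : IsLogBasis ξ) (j : Fin s) :
    ∃ i, ξ i j ≠ 1 := by
  by_contra! hξ
  have h1 : Submodule.span ℝ (Set.range fun i => fun j => Real.log (ξ i j)) ≤
      LinearMap.ker (LinearMap.proj j : (Fin s → ℝ) →ₗ[ℝ] ℝ) := by
    rw [Submodule.span_le]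
    rintro _ ⟨i, rfl⟩
    simp [hξ]
  rw [h.span] at h1
  have h2 : (LinearMap.proj j : (Fin s → ℝ) →ₗ[ℝ] ℝ) (Pi.single j 1) = 0 := h1 trivial
  simp at h2

/-- A polynomial that shares a complex root with an irreducible polynomial vanishes at all the
roots of the latter. -/
theorem aeval_eq_zero_of_irreducible {B P : ℤ[X]} (hB : Irreducible B) {β : ℂ}
    (hβ : aeval β B = 0) (hP : aeval β P = 0) {x : ℝ} (hx : aeval x B = 0) : aeval x P = 0 := by
  have hdeg : B.natDegree ≠ 0 := by
    intro h
    rw [Polynomial.eq_C_of_natDegree_eq_zero h, aeval_C] at hx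
    have h2 : B.coeff 0 = 0 := by simpa using hx
    exact hB.ne_zero (by rw [Polynomial.eq_C_of_natDegree_eq_zero h, h2, C_0])
  -- By Gauss's lemma `B` stays irreducible over `ℚ`, so it either divides `P` there or is coprime
  -- to it; the common root `β` excludes the latter.
  have hirr := (IsPrimitive.Int.irreducible_iff_irreducible_map_cast
    (hB.isPrimitive hdeg)).mp hB
  rcases (Classical.em (B.map (Int.castRingHom ℚ) ∣ P.map (Int.castRingHom ℚ))).symm.imp_left
    hirr.coprime_iff_not_dvd.mpr with ⟨u, v, h⟩ | ⟨Q, h⟩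
  · have := congrArg (aeval β) h
    simp only [map_add, map_mul, ← algebraMap_int_eq, aeval_map_algebraMap, hβ, hP] at this
    simp at this
  · have := congrArg (aeval x) h
    simpa only [map_mul, ← algebraMap_int_eq, aeval_map_algebraMap, hx, zero_mul] using this

section Fixed

variable {N s : ℕ} {M : Matrix (Fin N) (Fin N) ℤ} {α : Fin s → ℝ} {D : Fin s → ℤ[X]}

theorem IsPrimaryDirichletFamily.exists_aeval_ne_one (hD : IsPrimaryDirichletFamily M α D) {β : ℂ}
    (hβ : aeval β M.charpoly = 0) : ∃ i, aeval β (D i) ≠ 1 := by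
  obtain ⟨k, B, r, γ, P, e, hB, hγ, -, -, hlog, h0, hP, -⟩ := hD.primary
  by_contra! h
  rw [hB.prod, map_prod, Finset.prod_eq_zero_iff] at hβ
  obtain ⟨i, -, hi⟩ := hβ
  have hroot : ∀ j : Fin k, Nonempty (Fin (r j)) := fun j => by
    obtain ⟨x, hx⟩ := hB.realRoot j.succ (Fin.succ_ne_zero j)
    obtain ⟨l, -⟩ := ((hγ j).isRoot_iff x).mp hx
    exact ⟨l⟩
  rcases Fin.eq_zero_or_eq_succ i with rfl | ⟨j, rfl⟩
  -- Since `k ≥ 1`, some member of the family exists; it is congruent to `t` modulo `B 0`, so `β =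
  -- 1`, a real root of `B 0`.
  · obtain ⟨l⟩ := hroot ⟨0, hB.pos⟩
    obtain ⟨Q, hQ⟩ := h0 ⟨0, hB.pos⟩ l
    have h1 := congrArg (aeval β) hQ
    rw [map_sub, aeval_X, map_mul, hi, zero_mul, h, sub_eq_zero] at h1
    rw [← h1] at hi
    apply hB.noRealRoot 1
    have h2 : aeval (algebraMap ℝ ℂ 1) (B 0) = 0 := by rw [map_one]; exact hi
    rw [aeval_algebraMap_apply] at h2
    simpa using h2
  -- Here `P j l (β) = 1` for every `l`. Choosing `l` with `P j l ≠ 1` at the real root `γ j m`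
  -- contradicts the irreducibility of `B j.succ`.
  · obtain ⟨m⟩ := hroot j
    obtain ⟨l, hl⟩ := (hlog j).exists_ne_one m
    apply hl
    have h1 : aeval β (P j l - 1) = 0 := by
      obtain ⟨Q, hQ⟩ := hP j l
      have h2 := congrArg (aeval β) hQ
      rw [map_sub, map_mul, hi, zero_mul, h] at h2
      rw [map_sub, map_one]
      linear_combination -h2
    have h3 := aeval_eq_zero_of_irreducible (hB.irred j.succ (Fin.succ_ne_zero j)) hi h1
      (((hγ j).isRoot_iff (γ j m)).mpr ⟨m, rfl⟩)
    rw [map_sub, map_one, sub_eq_zero] at h3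
    exact h3

theorem IsPrimaryDirichletFamily.eq_zero_of_fixed (hD : IsPrimaryDirichletFamily M α D)
    (r : Fin N → ℝ) (hr : ∀ i, (aeval M (D i)).map (Int.cast : ℤ → ℝ) *ᵥ r = r) : r = 0 := by
  by_contra hne
  set ρ : Fin N → ℂ := fun i => (r i : ℂ) with hρ
  have hρ0 : ρ ≠ 0 := fun h => hne (funext fun i => Complex.ofReal_eq_zero.mp (congrFun h i))
  set A : Matrix (Fin N) (Fin N) ℂ := M.map (Int.cast : ℤ → ℂ) with hA
  -- The annihilator of the fixed vector. It contains the characteristic polynomial and all `D i -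
  -- 1`; as the vector is nonzero, its generator is not a unit, and a root `β` of the generator is a
  -- common root of them all.
  let I : Ideal ℂ[X] :=
    { carrier := {p | aeval A p *ᵥ ρ = 0}
      add_mem' := fun {p q} hp hq => by
        simp only [Set.mem_ofPred_eq] at *
        rw [map_add, Matrix.add_mulVec, hp, hq, add_zero]
      zero_mem' := by simp
      smul_mem' := fun c p hp => by
        simp only [Set.mem_ofPred_eq] at *
        rw [smul_eq_mul, map_mul, ← Matrix.mulVec_mulVec, hp, Matrix.mulVec_zero] }
  have hmem : ∀ p : ℤ[X], p.map (algebraMap ℤ ℂ) ∈ I ↔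
      (aeval M p).map (Int.cast : ℤ → ℂ) *ᵥ ρ = 0 := fun p => by
    change aeval A (p.map (algebraMap ℤ ℂ)) *ᵥ ρ = 0 ↔ _
    rw [aeval_map_algebraMap, SpectralData.aeval_map_cast]
  have hC : M.charpoly.map (algebraMap ℤ ℂ) ∈ I := by
    rw [hmem, Matrix.aeval_self_charpoly]; ext; simp [Matrix.mulVec, dotProduct]
  have hDI : ∀ i, (D i - 1).map (algebraMap ℤ ℂ) ∈ I := fun i => by
    rw [hmem]
    ext k
    have := congrArg (fun r : ℝ => (r : ℂ)) (congrFun (hr i) k)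
    have h1 : ((aeval M (D i)).map (Int.cast : ℤ → ℂ) *ᵥ ρ) k = ρ k := by
      simpa [Matrix.mulVec, dotProduct, hρ] using this
    rw [map_sub, map_one, Matrix.map_sub _ (fun a b => Int.cast_sub a b),
      Matrix.map_one _ Int.cast_zero Int.cast_one, Matrix.sub_mulVec, Matrix.one_mulVec,
      Pi.sub_apply, h1, sub_self, Pi.zero_apply]
  obtain ⟨g, hg⟩ := (IsPrincipalIdealRing.principal I).principal
  have hdvd : ∀ p ∈ I, g ∣ p := fun p hp => Ideal.mem_span_singleton.mp (by
    rw [hg] at hp; exact hp)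
  have hgI : g ∈ I := by rw [hg]; exact Ideal.mem_span_singleton_self g
  have hg0 : g ≠ 0 := fun h =>
    (M.charpoly_monic.map (algebraMap ℤ ℂ)).ne_zero (zero_dvd_iff.mp (h ▸ hdvd _ hC))
  have hdeg : g.degree ≠ 0 := by
    intro h
    have hu := Polynomial.isUnit_iff_degree_eq_zero.mpr h
    have h1 : (1 : ℂ[X]) ∈ I := (Ideal.eq_top_iff_one I).mp (Ideal.eq_top_of_isUnit_mem I hgI hu)
    have h2 : aeval A (1 : ℂ[X]) *ᵥ ρ = 0 := h1
    rw [map_one, Matrix.one_mulVec] at h2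
    exact hρ0 h2
  obtain ⟨β, hβ⟩ := IsAlgClosed.exists_root g hdeg
  have hroot : ∀ p : ℤ[X], p.map (algebraMap ℤ ℂ) ∈ I → aeval β p = 0 := fun p hp => by
    have := hβ.dvd (hdvd _ hp)
    rwa [IsRoot.def, eval_map_algebraMap] at this
  obtain ⟨i, hi⟩ := hD.exists_aeval_ne_one (hroot _ hC)
  have := hroot _ (hDI i)
  rw [map_sub, map_one, sub_eq_zero] at this
  exact hi this

end Fixed

section

open SpectralData Topology

/-! ### Differential forms on `T(M, 𝒟)` as invariant forms on `ℍ^s × ℂ^n` -/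

section Pull

variable {N s n : ℕ} {M : Matrix (Fin N) (Fin N) ℤ} {Λ : SpectralData M s n} {D : Fin s → ℤ[X]}
  {hM : IsTypeJ M} {hD : IsDirichletFamily M Λ.α D}

theorem chart_mem_atlas (x : HC s n) : chart hM hD x ∈ atlas (Model s n) (T hM hD) :=
  Set.mem_range_self x

theorem mem_chart_target (x : HC s n) : x.1 ∈ (chart hM hD x).target := by
  have h1 := (proj_isLocalHomeomorph hM hD).self_mem_localInverseAt_target (x := x)
  have h2 := (incl s n).map_source (x := x) (by simp [incl])
  have h3 := (incl s n).left_inv (x := x) (by simp [incl])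
  rw [incl_apply] at h2 h3
  rw [chart, OpenPartialHomeomorph.trans_target]
  refine ⟨h2, ?_⟩
  rw [Set.mem_preimage, h3]
  exact h1

/-- The changes of charts are the elements of the group. -/
theorem chart_transition {γ : Equiv.Perm (HC s n)} (hγ : γ ∈ group hD)
    {A : Model s n →L[ℂ] Model s n} {c : Model s n} (hA : ∀ p, (γ p).1 = A p.1 + c)
    {x x' : HC s n} {y : Model s n} (hy : y ∈ (chart hM hD x).target)
    (hy' : A y + c ∈ (chart hM hD x').target) :
    y ∈ ((chart hM hD x).symm.trans (chart hM hD x')).source ∧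
      (fun u => chart hM hD x' ((chart hM hD x).symm u)) =ᶠ[𝓝 y] fun u => A u + c := by
  have hkey : ∀ u ∈ (chart hM hD x).target, A u + c ∈ (chart hM hD x').target →
      (chart hM hD x').symm (A u + c) = (chart hM hD x).symm u := by
    intro u hu hu'
    obtain ⟨p, hp, hp'⟩ := chart_spec hM hD x hu
    obtain ⟨q, hq, hq'⟩ := chart_spec hM hD x' hu'
    rw [hp', hq']
    exact (proj_eq_iff hM hD q p).mpr ⟨γ, hγ, Subtype.ext (by rw [hA, hp, hq])⟩
  refine ⟨?_, ?_⟩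
  · rw [OpenPartialHomeomorph.trans_source]
    refine ⟨hy, ?_⟩
    rw [Set.mem_preimage, ← hkey y hy hy']
    exact (chart hM hD x').map_target hy'
  · have hcont : Continuous fun u : Model s n => A u + c := by fun_prop
    filter_upwards [(chart hM hD x).open_target.mem_nhds hy,
      ((chart hM hD x').open_target.preimage hcont).mem_nhds hy'] with u hu hu'
    rw [← hkey u hu hu']
    exact (chart hM hD x').right_inv hu'

/-- The change of charts coincides near `y` with the affine map `A u + c`, whose derivative is `A`.
-/
theorem DiffForm.form_eq_comp {k : ℕ} (η : DiffForm (Model s n) (T hM hD) k)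
    {γ : Equiv.Perm (HC s n)} (hγ : γ ∈ group hD)
    {A : Model s n →L[ℂ] Model s n} {c : Model s n} (hA : ∀ p, (γ p).1 = A p.1 + c)
    {x x' : HC s n} {y : Model s n} (hy : y ∈ (chart hM hD x).target)
    (hy' : A y + c ∈ (chart hM hD x').target) :
    η.form (chart hM hD x) y = (η.form (chart hM hD x') (A y + c)).compContinuousLinearMap
      (A.restrictScalars ℝ) := by
  obtain ⟨h1, h2⟩ := chart_transition (hM := hM) hγ hA hy hy'
  have h3 : HasFDerivAt (fun u : Model s n => A u + c) (A.restrictScalars ℝ) y :=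
    (A.restrictScalars ℝ).hasFDerivAt.add_const c
  rw [η.compat _ (chart_mem_atlas x) _ (chart_mem_atlas x') y h1, h2.fderiv_eq, h3.fderiv,
    show chart hM hD x' ((chart hM hD x).symm y) = A y + c from h2.self_of_nhds]

open Classical in
/-- The pullback of a differential form to `ℍ^s × ℂ^n`. -/
def DiffForm.pull {k : ℕ} (η : DiffForm (Model s n) (T hM hD) k) (y : Model s n) :
    Model s n [⋀^Fin k]→L[ℝ] ℝ :=
  if h : ∀ j, 0 < (y.1 j).im then η.form (chart hM hD ⟨y, h⟩) y else 0

theorem DiffForm.pull_coe {k : ℕ} (η : DiffForm (Model s n) (T hM hD) k) (p : HC s n) :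
    η.pull p.1 = η.form (chart hM hD p) p.1 := by
  rw [pull, dif_pos p.2]

theorem DiffForm.pull_eventuallyEq {k : ℕ} (η : DiffForm (Model s n) (T hM hD) k) (p : HC s n) :
    η.pull =ᶠ[𝓝 p.1] η.form (chart hM hD p) := by
  filter_upwards [(chart hM hD p).open_target.mem_nhds (mem_chart_target p)] with u hu
  obtain ⟨q, rfl, -⟩ := chart_spec hM hD p hu
  -- The identity of the group relates the charts centred at `q` and `p`.
  rw [η.pull_coe, η.form_eq_comp (A := ContinuousLinearMap.id ℂ _) (c := 0) (x := q) (x' := p)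
    (one_mem _) (by simp) (mem_chart_target q) (by simpa using hu)]
  ext v
  simp

theorem DiffForm.pull_group {k : ℕ} (η : DiffForm (Model s n) (T hM hD) k)
    {γ : Equiv.Perm (HC s n)} (hγ : γ ∈ group hD)
    {A : Model s n →L[ℂ] Model s n} {c : Model s n} (hA : ∀ p, (γ p).1 = A p.1 + c)
    (p : HC s n) (v : Fin k → Model s n) :
    η.pull p.1 v = η.pull (γ p).1 fun i => A (v i) := by
  rw [η.pull_coe, η.pull_coe, η.form_eq_comp hγ hA (mem_chart_target p)
    (x' := γ p) (by rw [← hA]; exact mem_chart_target _), ← hA]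
  rfl

theorem DiffForm.contDiffAt_pull {k : ℕ} (η : DiffForm (Model s n) (T hM hD) k) (p : HC s n) :
    ContDiffAt ℝ ∞ η.pull p.1 :=
  ((η.smooth _ (chart_mem_atlas p)).contDiffAt
    ((chart hM hD p).open_target.mem_nhds (mem_chart_target p))).congr_of_eventuallyEq
      (η.pull_eventuallyEq p)

theorem DiffForm.extDeriv_pull {k : ℕ} (η : DiffForm (Model s n) (T hM hD) k) (p : HC s n) :
    extDeriv η.pull p.1 = extDeriv (η.form (chart hM hD p)) p.1 :=
  (η.pull_eventuallyEq p).extDeriv_eq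

end Pull

/-- The zero form. -/
instance {E X : Type*} [NormedAddCommGroup E] [NormedSpace ℂ E] [NormedSpace ℝ E]
    [IsScalarTower ℝ ℂ E] [TopologicalSpace X] [ChartedSpace E X] (k : ℕ) :
    Zero (DiffForm E X k) where
  zero :=
    { form := fun _ _ => 0
      smooth := fun _ _ => contDiffOn_const
      compat := fun _ _ _ _ _ _ => by ext; simp }

theorem AdmitsKahler.admitsLCK {E X : Type*} [NormedAddCommGroup E] [NormedSpace ℂ E]
    [NormedSpace ℝ E] [IsScalarTower ℝ ℂ E] [TopologicalSpace X] [ChartedSpace E X]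
    (h : AdmitsKahler E X) : AdmitsLCK E X := by
  obtain ⟨Ω, hΩ, hcl⟩ := h
  have h0 : ∀ e y, (0 : DiffForm E X 1).form e y = 0 := fun _ _ => rfl
  refine ⟨Ω, 0, hΩ, fun e _ y _ => ?_, fun e he y hy u v w => ?_⟩
  · have : (0 : DiffForm E X 1).form e = fun _ => 0 := rfl
    rw [this]
    ext
    simp [extDeriv, ContinuousAlternatingMap.alternatizeUncurryFin_apply]
  · rw [hcl e he y hy, h0]
    simp

end

section

open MeasureTheory Topology

/-! ### Averages of closed periodic forms -/

section Average

variable {N : ℕ} {E : Type*} [NormedAddCommGroup E] [NormedSpace ℝ E]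
  (L : (Fin N → ℝ) →L[ℝ] E) (G : E → ℝ)

/-- The average of a function in the directions of a lattice. -/
def average (y : E) : ℝ := ∫ x in cube N, G (y + L x)

variable {L G} {U : Set E}

theorem continuous_comp_lattice (hG : ContinuousOn G U) (hL : ∀ y ∈ U, ∀ x, y + L x ∈ U) {y : E}
    (hy : y ∈ U) : Continuous fun x => G (y + L x) :=
  hG.comp_continuous (by fun_prop) (hL y hy)

theorem average_pos (hG : ContinuousOn G U) (hL : ∀ y ∈ U, ∀ x, y + L x ∈ U)
    (hpos : ∀ y ∈ U, 0 < G y) {y : E} (hy : y ∈ U) : 0 < average L G y := by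
  rw [average, integral_pos_iff_support_of_nonneg]
  · have : (Function.support fun x => G (y + L x)) = Set.univ :=
      Set.eq_univ_of_forall fun x => (hpos _ (hL y hy x)).ne'
    rw [this, measure_univ]
    exact one_pos
  · exact fun x => (hpos _ (hL y hy x)).le
  · exact integrableOn_cube (continuous_comp_lattice hG hL hy)

theorem average_add_lattice (hL : ∀ y ∈ U, ∀ x, y + L x ∈ U)
    (hper : ∀ (l : Fin N → ℤ), ∀ y ∈ U, G (y + L (intVec l)) = G y) {y : E} (hy : y ∈ U)
    (t : Fin N → ℝ) : average L G (y + L t) = average L G y := by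
  have := setIntegral_cube_add (φ := fun x => G (y + L x)) (fun l x => by
    rw [map_add, add_comm (L _), ← add_assoc, hper l _ (hL y hy x)]) t
  simpa only [average, map_add, add_assoc] using this

variable [ProperSpace E]

theorem hasFDerivAt_average (hU : IsOpen U) (hG : ContDiffOn ℝ 1 G U)
    (hL : ∀ y ∈ U, ∀ x, y + L x ∈ U) {y : E} (hy : y ∈ U) :
    HasFDerivAt (average L G) (∫ x in cube N, fderiv ℝ G (y + L x)) y :=
  hasFDerivAt_integral_cube hU
    (fun _ hz => ((hG.differentiableOn one_ne_zero).differentiableAt (hU.mem_nhds hz)).hasFDerivAt)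
    (hG.continuousOn_fderiv_of_isOpen hU le_rfl) L hL hy

theorem fderiv_average_apply (hU : IsOpen U) (hG : ContDiffOn ℝ 1 G U)
    (hL : ∀ y ∈ U, ∀ x, y + L x ∈ U) {y : E} (hy : y ∈ U) (u : E) :
    fderiv ℝ (average L G) y u = ∫ x in cube N, fderiv ℝ G (y + L x) u := by
  rw [(hasFDerivAt_average hU hG hL hy).fderiv, ContinuousLinearMap.integral_apply]
  exact integrableOn_cube ((hG.continuousOn_fderiv_of_isOpen hU le_rfl).comp_continuous
    (by fun_prop) (hL y hy))

/-- The average is constant along the line in direction `L t`, by translation invariance of the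
integral of a periodic function. -/
theorem fderiv_average_lattice (hU : IsOpen U) (hG : ContDiffOn ℝ 1 G U)
    (hL : ∀ y ∈ U, ∀ x, y + L x ∈ U)
    (hper : ∀ (l : Fin N → ℤ), ∀ y ∈ U, G (y + L (intVec l)) = G y) {y : E} (hy : y ∈ U)
    (t : Fin N → ℝ) : fderiv ℝ (average L G) y (L t) = 0 := by
  have h1 := (hasFDerivAt_average hU hG hL hy).differentiableAt.hasFDerivAt.hasLineDerivAt (L t)
  refine HasDerivAt.unique h1 ?_
  have : (fun τ : ℝ => average L G (y + τ • L t)) = fun _ => average L G y := by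
    ext τ
    rw [← map_smul]
    exact average_add_lattice hL hper hy _
  rw [this]
  exact hasDerivAt_const _ _

/-- The average of a closed periodic 2-form is constant in the directions of the lattice. -/
theorem average_const (hU : IsOpen U) (hUc : Convex ℝ U) {F : E → E → E → ℝ}
    (hF : ∀ u v, ContDiffOn ℝ 1 (F u v) U) (hL : ∀ y ∈ U, ∀ x, y + L x ∈ U)
    (hper : ∀ (l : Fin N → ℤ), ∀ y ∈ U, ∀ u v, F u v (y + L (intVec l)) = F u v y)
    (hcl : ∀ y ∈ U, ∀ u v w, fderiv ℝ (F v w) y u - fderiv ℝ (F u w) y v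
      + fderiv ℝ (F u v) y w = 0) (t t' : Fin N → ℝ) {y y' : E} (hy : y ∈ U) (hy' : y' ∈ U) :
    average L (F (L t) (L t')) y = average L (F (L t) (L t')) y' := by
  refine hU.is_const_of_fderiv_eq_zero (𝕜 := ℝ) hUc.isPreconnected (fun z hz =>
    (hasFDerivAt_average hU (hF _ _) hL hz).differentiableAt.differentiableWithinAt)
    (fun z hz => ?_) hy hy'
  ext u
  have hint : ∀ u v w, IntegrableOn (fun x => fderiv ℝ (F v w) (z + L x) u) (cube N) :=
    fun u v w => integrableOn_cube ((((hF v w).continuousOn_fderiv_of_isOpen hU le_rfl).comp_continuous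
      (by fun_prop) (hL z hz)).clm_apply continuous_const)
  -- Closedness is averaged on the triple `u`, `L t`, `L t'`. Two of the three terms are derivatives
  -- of averages in lattice directions and vanish, so the derivative in the arbitrary direction `u`
  -- vanishes too.
  have h0 : ∫ x in cube N, (fderiv ℝ (F (L t) (L t')) (z + L x) u
      - fderiv ℝ (F u (L t')) (z + L x) (L t) + fderiv ℝ (F u (L t)) (z + L x) (L t')) = 0 := by
    simp only [hcl _ (hL z hz _), integral_zero]
  rw [integral_add (by exact (hint _ _ _).sub (hint _ _ _)) (hint _ _ _),
    integral_sub (hint _ _ _) (hint _ _ _),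
    ← fderiv_average_apply hU (hF _ _) hL hz, ← fderiv_average_apply hU (hF _ _) hL hz,
    ← fderiv_average_apply hU (hF _ _) hL hz,
    fderiv_average_lattice hU (hF _ _) hL (fun l y hy => hper l y hy _ _) hz,
    fderiv_average_lattice hU (hF _ _) hL (fun l y hy => hper l y hy _ _) hz, sub_zero,
    add_zero] at h0
  simpa using h0

end Average

end

section

open SpectralData Topology

/-! ### The domain `ℍ^s × ℂ^n` and its lattice translations -/

section Domain

variable {N s n : ℕ} {M : Matrix (Fin N) (Fin N) ℤ}

/-- `ℍ^s × ℂ^n` as a subset of `ℂ^s × ℂ^n`. -/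
def domain (s n : ℕ) : Set (Model s n) := {p | ∀ j, 0 < (p.1 j).im}

theorem isOpen_domain (s n : ℕ) : IsOpen (domain s n) := isOpen_HC s n

theorem convex_domain (s n : ℕ) : Convex ℝ (domain s n) := by
  intro x hx y hy a b ha hb hab j
  have h1 : ((a • x + b • y).1 j).im = a * (x.1 j).im + b * (y.1 j).im := by
    simp
  rw [h1]
  rcases ha.eq_or_lt with rfl | ha
  · rw [zero_add] at hab
    rw [hab, zero_mul, zero_add, one_mul]
    exact hy j
  · exact add_pos_of_pos_of_nonneg (mul_pos ha (hx j)) (mul_nonneg hb (hy j).le)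

theorem add_lin_mem_domain (Λ : SpectralData M s n) {y : Model s n} (hy : y ∈ domain s n)
    (x : Fin N → ℝ) : y + Λ.lin x ∈ domain s n := by
  intro j
  rw [Prod.fst_add, Pi.add_apply, lin_fst, Complex.add_im, Complex.ofReal_im, add_zero]
  exact hy j

theorem op_mem_domain (Λ : SpectralData M s n) {P : ℤ[X]} (hP : ∀ j, 0 < aeval (Λ.α j) P)
    {y : Model s n} (hy : y ∈ domain s n) : Λ.op P y ∈ domain s n :=
  (Λ.hcMap P hP ⟨y, hy⟩).2

variable {Λ : SpectralData M s n} {D : Fin s → ℤ[X]}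

/-- All the translations by lattice vectors belong to the group. -/
theorem exists_translation (hD : IsDirichletFamily M Λ.α D) (l : Fin N → ℤ) :
    ∃ γ ∈ group hD, ∀ p, (γ p).1 = p.1 + Λ.lat l := by
  let H : AddSubgroup (Fin N → ℤ) :=
    { carrier := {l | ∃ γ ∈ group hD, ∀ p, (γ p).1 = p.1 + Λ.lat l}
      add_mem' := by
        rintro l l' ⟨γ, hγ, h⟩ ⟨γ', hγ', h'⟩
        exact ⟨γ * γ', mul_mem hγ hγ', fun p => by
          rw [Equiv.Perm.mul_apply, h, h', lat_add, add_assoc, add_comm (Λ.lat l)]⟩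
      zero_mem' := ⟨1, one_mem _, fun p => by simp [lat_zero]⟩
      neg_mem' := by
        rintro l ⟨γ, hγ, h⟩
        refine ⟨γ⁻¹, inv_mem hγ, fun p => ?_⟩
        have := h (γ⁻¹ p)
        rw [show γ (γ⁻¹ p) = p from γ.apply_symm_apply p] at this
        rw [this, lat_neg]
        abel }
  have h1 : ∀ k, Pi.single k 1 ∈ H := fun k =>
    ⟨Λ.trans k, Subgroup.subset_closure (Or.inr ⟨k, rfl⟩), fun p => by rw [lat_single, trans_coe]⟩
  have h2 : l = ∑ k, l k • Pi.single k 1 := by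
    ext i; simp [Finset.sum_apply, Pi.single_apply]
  have h3 : l ∈ H := by
    rw [h2]
    exact sum_mem fun k _ => zsmul_mem (h1 k) _
  exact h3

end Domain

/-! ### Potentials of closed invariant 1-forms -/

section Potential

variable {N s n : ℕ} {M : Matrix (Fin N) (Fin N) ℤ} {Λ : SpectralData M s n} {D : Fin s → ℤ[X]}
  {hM : IsTypeJ M} {hD : IsDirichletFamily M Λ.α D}

theorem DiffForm.contDiffOn_pull {k : ℕ} (η : DiffForm (Model s n) (T hM hD) k) :
    ContDiffOn ℝ ∞ η.pull (domain s n) :=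
  fun y hy => (η.contDiffAt_pull ⟨y, hy⟩).contDiffWithinAt

theorem DiffForm.differentiableAt_pull {k : ℕ} (η : DiffForm (Model s n) (T hM hD) k)
    {y : Model s n} (hy : y ∈ domain s n) : DifferentiableAt ℝ η.pull y :=
  (η.contDiffAt_pull ⟨y, hy⟩).differentiableAt (by simp)

theorem DiffForm.contDiffOn_pull_apply {k : ℕ} (η : DiffForm (Model s n) (T hM hD) k)
    (v : Fin k → Model s n) : ContDiffOn ℝ ∞ (fun y => η.pull y v) (domain s n) :=
  (ContinuousAlternatingMap.apply ℝ (Model s n) ℝ v).contDiff.comp_contDiffOn η.contDiffOn_pull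

/-- A closed 1-form on the quotient is exact on `ℍ^s × ℂ^n`. -/
theorem exists_potential {θ : DiffForm (Model s n) (T hM hD) 1} (hθ : IsClosedForm θ) :
    ∃ f : Model s n → ℝ, ContDiffOn ℝ 1 f (domain s n) ∧
      ∀ y ∈ domain s n, ∀ u, fderiv ℝ f y u = θ.pull y ![u] := by
  let e := ContinuousAlternatingMap.ofSubsingletonLIE (𝕜 := ℝ) (E := Model s n) (F := ℝ) (0 : Fin 1)
  let ϑ : Model s n → Model s n →L[ℝ] ℝ := fun y => e.symm (θ.pull y)
  have hϑ : ∀ y u, ϑ y u = θ.pull y ![u] := by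
    intro y u
    have h1 : e (ϑ y) ![u] = θ.pull y ![u] := by rw [e.apply_symm_apply]
    exact h1
  have hsm : ContDiffOn ℝ ∞ ϑ (domain s n) :=
    e.symm.contDiff.comp_contDiffOn θ.contDiffOn_pull
  have hdiff : DifferentiableOn ℝ ϑ (domain s n) := hsm.differentiableOn (by simp)
  -- Poincaré lemma on a convex open set: closedness of the 1-form is the symmetry of its
  -- derivative.
  obtain ⟨f, hf⟩ := (convex_domain s n).exists_forall_hasFDerivAt_of_fderiv_symmetric
    (isOpen_domain s n) hdiff (fun y hy u v => by
      have hd := hdiff.differentiableAt ((isOpen_domain s n).mem_nhds hy)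
      have h1 : ∀ u v, fderiv ℝ ϑ y u v = fderiv ℝ (fun y => θ.pull y ![v]) y u := by
        intro u v
        have : (fun y => θ.pull y ![v]) = fun y => ϑ y v := funext fun y => (hϑ y v).symm
        rw [this, fderiv_clm_apply hd (differentiableAt_const v)]
        simp
      have h2 : extDeriv θ.pull y ![u, v] = 0 := by
        rw [θ.extDeriv_pull ⟨y, hy⟩, hθ _ (chart_mem_atlas _) y (mem_chart_target _)]
        rfl
      rw [extDeriv_apply (θ.differentiableAt_pull hy), Fin.sum_univ_two] at h2
      have e0 : (0 : Fin 2).removeNth ![u, v] = ![v] := by ext1 i; fin_cases i; rfl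
      have e1 : (1 : Fin 2).removeNth ![u, v] = ![u] := by ext1 i; fin_cases i; rfl
      rw [e0, e1] at h2
      rw [h1, h1]
      simp at h2
      linarith)
  refine ⟨f, ?_, fun y hy u => by rw [(hf y hy).fderiv, hϑ]⟩
  rw [show (1 : ℕ∞ω) = 0 + 1 from rfl, contDiffOn_succ_iff_fderiv_of_isOpen (isOpen_domain s n)]
  refine ⟨fun y hy => (hf y hy).differentiableAt.differentiableWithinAt, by simp, ?_⟩
  exact (hsm.of_le (by simp)).congr fun y hy => (hf y hy).fderiv

/-- A potential of an invariant 1-form is invariant up to constants. -/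
theorem potential_add_const {θ : DiffForm (Model s n) (T hM hD) 1} {f : Model s n → ℝ}
    (hf : ContDiffOn ℝ 1 f (domain s n))
    (hfθ : ∀ y ∈ domain s n, ∀ u, fderiv ℝ f y u = θ.pull y ![u])
    {γ : Equiv.Perm (HC s n)} (hγ : γ ∈ group hD) {A : Model s n →L[ℂ] Model s n} {c : Model s n}
    (hA : ∀ p, (γ p).1 = A p.1 + c) :
    ∃ σ : ℝ, ∀ y ∈ domain s n, f (A y + c) = f y + σ := by
  have hmem : ∀ y ∈ domain s n, A y + c ∈ domain s n := fun y hy => by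
    rw [← hA ⟨y, hy⟩]; exact (γ ⟨y, hy⟩).2
  have hd : ∀ y ∈ domain s n, HasFDerivAt f (fderiv ℝ f y) y := fun y hy =>
    ((hf.differentiableOn one_ne_zero).differentiableAt
      ((isOpen_domain s n).mem_nhds hy)).hasFDerivAt
  have hd' : ∀ y ∈ domain s n, HasFDerivAt (fun y => f (A y + c) - f y)
      ((fderiv ℝ f (A y + c)).comp (A.restrictScalars ℝ) - fderiv ℝ f y) y := fun y hy =>
    ((hd _ (hmem y hy)).comp y ((A.restrictScalars ℝ).hasFDerivAt.add_const c)).sub (hd y hy)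
  obtain ⟨p⟩ := (inferInstance : Nonempty (HC s n))
  refine ⟨f (A p.1 + c) - f p.1, fun y hy => ?_⟩
  -- By invariance of `θ`, the difference of `f` composed with `γ` and `f` has zero derivative on a
  -- connected set.
  have hconst := (isOpen_domain s n).is_const_of_fderiv_eq_zero (𝕜 := ℝ)
    (convex_domain s n).isPreconnected
    (fun y hy => (hd' y hy).differentiableAt.differentiableWithinAt) (fun y hy => by
      rw [(hd' y hy).fderiv]
      refine ContinuousLinearMap.ext fun u => ?_
      have h1 := θ.pull_group hγ hA ⟨y, hy⟩ ![u]
      rw [hA] at h1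
      have h2 : (fun i => A (![u] i)) = ![A u] := by ext1 i; fin_cases i; rfl
      rw [h2] at h1
      change fderiv ℝ f (A y + c) (A u) - fderiv ℝ f y u = 0
      rw [hfθ _ (hmem y hy), hfθ y hy, h1, sub_self]) hy p.2
  linarith

end Potential

/-! ### Periodicity of the potential -/

section Periodic

variable {N s n : ℕ} {M : Matrix (Fin N) (Fin N) ℤ} {Λ : SpectralData M s n} {D : Fin s → ℤ[X]}

/-- For a primary family, a function that the group changes by constants only is periodic. -/
theorem IsPrimaryDirichletFamily.periodic_of_add_const (hD : IsPrimaryDirichletFamily M Λ.α D)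
    {f : Model s n → ℝ}
    (hlat : ∀ l, ∃ ρ : ℝ, ∀ y ∈ domain s n, f (y + Λ.lat l) = f y + ρ)
    (hop : ∀ i, ∃ σ : ℝ, ∀ y ∈ domain s n, f (Λ.op (D i) y) = f y + σ)
    (l : Fin N → ℤ) {y : Model s n} (hy : y ∈ domain s n) : f (y + Λ.lat l) = f y := by
  choose ρ hρ using hlat
  have hmem : ∀ y ∈ domain s n, ∀ l, y + Λ.lat l ∈ domain s n := fun y hy l =>
    add_lin_mem_domain Λ hy _
  let R : (Fin N → ℤ) →+ ℝ := AddMonoidHom.mk' ρ fun l l' => by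
    have h1 := hρ (l + l') y hy
    rw [lat_add, add_comm (Λ.lat l), ← add_assoc, hρ l _ (hmem y hy l'), hρ l' y hy] at h1
    linarith
  have hsum : ∀ l, R l = ∑ k, (l k : ℝ) * R (Pi.single k 1) := by
    intro l
    have h2 : l = ∑ k, l k • Pi.single k 1 := by
      ext i; simp [Finset.sum_apply, Pi.single_apply]
    conv_lhs => rw [h2]
    rw [map_sum]
    exact Finset.sum_congr rfl fun k _ => by rw [map_zsmul, zsmul_eq_mul]
  -- Compute `f` at `D i (y + lat l)` in two ways; the constant `σ` cancels.
  have hinv : ∀ i l, R ((aeval M (D i))ᵀ *ᵥ l) = R l := by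
    intro i l
    obtain ⟨σ, hσ⟩ := hop i
    have h1 := hσ _ (hmem y hy l)
    rw [map_add, op_lat, hρ _ _ (op_mem_domain Λ (hD.pos i) hy), hσ y hy, hρ l y hy] at h1
    change ρ _ = ρ _
    linarith
  -- Read in coordinates, invariance under the transposes says that the vector of values of `R` on
  -- the basis is fixed by each `D i (M)`.
  have hr := hD.eq_zero_of_fixed (fun k => R (Pi.single k 1)) fun i => by
    ext k
    have h1 := hinv i (Pi.single k 1)
    rw [hsum] at h1
    rw [← h1]
    simp [Matrix.mulVec, dotProduct, Matrix.transpose_apply, Pi.single_apply]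
  have h0 : R l = 0 := by
    rw [hsum]
    exact Finset.sum_eq_zero fun k _ => by rw [congrFun hr k, Pi.zero_apply, mul_zero]
  rw [hρ l y hy, show ρ l = 0 from h0, add_zero]

end Periodic

end

section

open MeasureTheory SpectralData Topology

/-! ### Algebra of alternating 2-forms -/

section TwoForms

variable {E : Type*} [NormedAddCommGroup E] [NormedSpace ℝ E] (B : E [⋀^Fin 2]→L[ℝ] ℝ)

theorem two_form_add_left (u v w : E) : B ![u + v, w] = B ![u, w] + B ![v, w] :=
  B.toAlternatingMap.map_vecCons_add ![w] u v

theorem two_form_smul_left (c : ℝ) (u v : E) : B ![c • u, v] = c * B ![u, v] :=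
  B.toAlternatingMap.map_vecCons_smul ![v] c u

theorem two_form_swap (u v : E) : B ![u, v] = -B ![v, u] := by
  have h := B.toAlternatingMap.map_swap ![v, u] (i := 0) (j := 1) (by decide)
  have h1 : (![v, u] ∘ Equiv.swap (0 : Fin 2) 1) = ![u, v] := by
    ext1 i; fin_cases i <;> rfl
  rw [h1] at h
  exact h

end TwoForms

/-! ### The closed form `e^{-f} Ω` and its average -/

section LCK

variable {N s n : ℕ} {M : Matrix (Fin N) (Fin N) ℤ} {Λ : SpectralData M s n} {D : Fin s → ℤ[X]}
  {hM : IsTypeJ M} {hD : IsDirichletFamily M Λ.α D}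

/-- The components of the form `e^{-f} Ω` on `ℍ^s × ℂ^n`. -/
def rescaled (Ω : DiffForm (Model s n) (T hM hD) 2) (f : Model s n → ℝ) (u v : Model s n)
    (y : Model s n) : ℝ :=
  Real.exp (-f y) * Ω.pull y ![u, v]

variable {Ω : DiffForm (Model s n) (T hM hD) 2} {θ : DiffForm (Model s n) (T hM hD) 1}
  {f : Model s n → ℝ}

theorem contDiffOn_rescaled (hf : ContDiffOn ℝ 1 f (domain s n)) (u v : Model s n) :
    ContDiffOn ℝ 1 (rescaled Ω f u v) (domain s n) :=
  (Real.contDiff_exp.comp_contDiffOn hf.neg).mul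
    ((Ω.contDiffOn_pull_apply ![u, v]).of_le (by simp))

/-- The rescaled form is closed. -/
theorem rescaled_closed (hΩθ : ExtDerivEqWedge Ω θ) (hf : ContDiffOn ℝ 1 f (domain s n))
    (hfθ : ∀ y ∈ domain s n, ∀ u, fderiv ℝ f y u = θ.pull y ![u]) {y : Model s n}
    (hy : y ∈ domain s n) (u v w : Model s n) :
    fderiv ℝ (rescaled Ω f v w) y u - fderiv ℝ (rescaled Ω f u w) y v
      + fderiv ℝ (rescaled Ω f u v) y w = 0 := by
  have hU := (isOpen_domain s n).mem_nhds hy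
  have hfd := (hf.differentiableOn one_ne_zero).differentiableAt hU
  -- The product rule, in the form `d(e^{-f} Ω) = e^{-f} (dΩ - θ ∧ Ω)`.
  have key : ∀ u v w, fderiv ℝ (rescaled Ω f v w) y u = Real.exp (-f y) *
      (fderiv ℝ (fun y => Ω.pull y ![v, w]) y u - θ.pull y ![u] * Ω.pull y ![v, w]) := by
    intro u v w
    have h1 : HasFDerivAt (fun y => Ω.pull y ![v, w]) _ y :=
      (((Ω.contDiffOn_pull_apply ![v, w]).differentiableOn (by simp)).differentiableAt hU).hasFDerivAt
    have h2 := (hfd.hasFDerivAt.neg.exp).mul h1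
    rw [show rescaled Ω f v w = fun y => Real.exp (-f y) * Ω.pull y ![v, w] from rfl]
    have h3 : fderiv ℝ (fun y => Real.exp (-f y) * Ω.pull y ![v, w]) y = _ := h2.fderiv
    rw [h3, ← hfθ y hy]
    simp
    ring
  have h0 : extDeriv Ω.pull y ![u, v, w] = θ.pull y ![u] * Ω.pull y ![v, w]
      - θ.pull y ![v] * Ω.pull y ![u, w] + θ.pull y ![w] * Ω.pull y ![u, v] := by
    rw [Ω.extDeriv_pull ⟨y, hy⟩, Ω.pull_coe ⟨y, hy⟩, θ.pull_coe ⟨y, hy⟩]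
    exact hΩθ _ (chart_mem_atlas _) y (mem_chart_target _) u v w
  rw [extDeriv_apply (Ω.differentiableAt_pull hy), Fin.sum_univ_three] at h0
  have e0 : (0 : Fin 3).removeNth ![u, v, w] = ![v, w] := by ext1 i; fin_cases i <;> rfl
  have e1 : (1 : Fin 3).removeNth ![u, v, w] = ![u, w] := by ext1 i; fin_cases i <;> rfl
  have e2 : (2 : Fin 3).removeNth ![u, v, w] = ![u, v] := by ext1 i; fin_cases i <;> rfl
  rw [e0, e1, e2] at h0
  simp at h0
  rw [key, key, key]
  linear_combination Real.exp (-f y) * h0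

theorem rescaled_lattice (hfper : ∀ (l : Fin N → ℤ), ∀ y ∈ domain s n, f (y + Λ.lat l) = f y)
    (l : Fin N → ℤ) {y : Model s n} (hy : y ∈ domain s n) (u v : Model s n) :
    rescaled Ω f u v (y + Λ.lat l) = rescaled Ω f u v y := by
  obtain ⟨γ, hγ, h⟩ := exists_translation hD l
  have h1 := Ω.pull_group hγ (A := ContinuousLinearMap.id ℂ _) (c := Λ.lat l) h ⟨y, hy⟩ ![u, v]
  rw [h] at h1
  rw [rescaled, rescaled, hfper l y hy, h1]
  rfl

theorem g_eq_opEquiv (i : Fin s) (p : HC s n) :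
    (g hD i p).1 = (Λ.opEquiv (D i) (hD.det i) (hD.pos i) : Model s n →L[ℂ] Model s n) p.1 + 0 := by
  rw [add_zero]; rfl

theorem g_mem_group (i : Fin s) : g hD i ∈ group hD := Subgroup.subset_closure (Or.inl ⟨i, rfl⟩)

/-- `Ω` is invariant under `g i`, and only the factor `e^{-f}` changes, by the constant `e^{-σ}`. -/
theorem rescaled_op {i : Fin s} {σ : ℝ}
    (hσ : ∀ y ∈ domain s n, f (Λ.op (D i) y) = f y + σ) {y : Model s n} (hy : y ∈ domain s n)
    (u v : Model s n) : rescaled Ω f (Λ.op (D i) u) (Λ.op (D i) v) (Λ.op (D i) y) =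
      Real.exp (-σ) * rescaled Ω f u v y := by
  have h1 := Ω.pull_group (g_mem_group i) (g_eq_opEquiv i) ⟨y, hy⟩ ![u, v]
  have h2 : (fun k => (Λ.opEquiv (D i) (hD.det i) (hD.pos i) : Model s n →L[ℂ] Model s n)
      (![u, v] k)) = ![Λ.op (D i) u, Λ.op (D i) v] := by
    ext1 k; fin_cases k <;> rfl
  rw [h2, g_coe] at h1
  rw [rescaled, rescaled, hσ y hy, ← h1, neg_add, Real.exp_add]
  ring

/-- On a manifold `T(M, 𝒟)` of a primary family which is locally conformally Kähler, all the
matrices `D i (M)` are diagonalizable. -/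
theorem isDiagonalizable_of_admitsLCK (hM : IsTypeJ M) (hD : IsPrimaryDirichletFamily M Λ.α D)
    (h : AdmitsLCK (Model s n) (T hM hD.toIsDirichletFamily)) (i : Fin s) :
    IsDiagonalizable ((aeval M (D i)).map (Int.cast : ℤ → ℂ)) := by
  obtain ⟨Ω, θ, hΩ, hθ, hΩθ⟩ := h
  obtain ⟨f, hf, hfθ⟩ := exists_potential hθ
  have hop : ∀ i, ∃ σ : ℝ, ∀ y ∈ domain s n, f (Λ.op (D i) y) = f y + σ := fun i => by
    obtain ⟨σ, hσ⟩ := potential_add_const hf hfθ (g_mem_group i) (g_eq_opEquiv i)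
    exact ⟨σ, fun y hy => by rw [← hσ y hy, add_zero]; rfl⟩
  have hfper : ∀ (l : Fin N → ℤ), ∀ y ∈ domain s n, f (y + Λ.lat l) = f y := fun l y hy =>
    hD.periodic_of_add_const (fun l => by
      obtain ⟨γ, hγ, h⟩ := exists_translation hD.toIsDirichletFamily l
      exact potential_add_const hf hfθ hγ (A := ContinuousLinearMap.id ℂ _) h) hop l hy
  obtain ⟨σ, hσ⟩ := hop i
  obtain ⟨p, hp⟩ : (domain s n).Nonempty :=
    let ⟨p⟩ := (inferInstance : Nonempty (HC s n)); ⟨p.1, p.2⟩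
  let L : (Fin N → ℝ) →L[ℝ] Model s n := Λ.lin.toContinuousLinearMap
  have hLdef : ∀ x, L x = Λ.lin x := fun x => rfl
  have hL : ∀ y ∈ domain s n, ∀ x, y + L x ∈ domain s n := fun y hy => add_lin_mem_domain Λ hy
  have hF : ∀ u v, ContDiffOn ℝ 1 (rescaled Ω f u v) (domain s n) := contDiffOn_rescaled hf
  have hper : ∀ (l : Fin N → ℤ), ∀ y ∈ domain s n, ∀ u v,
      rescaled Ω f u v (y + L (intVec l)) = rescaled Ω f u v y := fun l y hy u v =>
    rescaled_lattice hfper l hy u v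
  have hint : ∀ u v, IntegrableOn (fun x => rescaled Ω f u v (p + L x)) (cube N) := fun u v =>
    integrableOn_cube (continuous_comp_lattice (hF u v).continuousOn hL hp)
  have hherm : ∀ y ∈ domain s n, ∀ u v,
      Ω.pull y ![Complex.I • u, Complex.I • v] = Ω.pull y ![u, v] := fun y hy u v => by
    rw [Ω.pull_coe ⟨y, hy⟩]
    exact (hΩ _ (chart_mem_atlas _) y (mem_chart_target _)).1 u v
  have hpos : ∀ y ∈ domain s n, ∀ u, u ≠ 0 → 0 < Ω.pull y ![u, Complex.I • u] :=
    fun y hy u hu => by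
      rw [Ω.pull_coe ⟨y, hy⟩]
      exact (hΩ _ (chart_mem_atlas _) y (mem_chart_target _)).2 u hu
  have hswap : ∀ u v, average L (rescaled Ω f u v) p = -average L (rescaled Ω f v u) p := by
    intro u v
    simp only [average, rescaled]
    rw [← integral_neg]
    exact integral_congr_ae (.of_forall fun x => by
      simp only [two_form_swap (Ω.pull _) u v, mul_neg])
  have hadd : ∀ u v w, average L (rescaled Ω f (u + v) w) p =
      average L (rescaled Ω f u w) p + average L (rescaled Ω f v w) p := by
    intro u v w
    rw [average, average, average, ← integral_add (hint u w) (hint v w)]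
    exact integral_congr_ae (.of_forall fun x => by
      simp only [rescaled, two_form_add_left, mul_add])
  have hsmul : ∀ (c : ℝ) u v, average L (rescaled Ω f (c • u) v) p =
      c * average L (rescaled Ω f u v) p := by
    intro c u v
    rw [average, average, ← integral_const_mul]
    exact integral_congr_ae (.of_forall fun x => by
      simp only [rescaled, two_form_smul_left, mul_left_comm])
  -- Only the directions `0 × ℂ^n` matter: they lie in the real span of the lattice, where the
  -- averaged form is constant.
  let ι : (Fin n → ℂ) →ₗ[ℂ] Model s n := LinearMap.inr ℂ _ _
  have hsmul' : ∀ (c : ℝ) z, ι ((c : ℂ) • z) = c • ι z := fun c z => by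
    rw [map_smul, Complex.coe_smul]
  have hconst : ∀ z z', ∀ y ∈ domain s n, average L (rescaled Ω f (ι z) (ι z')) y =
      average L (rescaled Ω f (ι z) (ι z')) p := by
    intro z z' y hy
    obtain ⟨t, ht⟩ := Λ.exists_lin_eq z
    obtain ⟨t', ht'⟩ := Λ.exists_lin_eq z'
    have := average_const (isOpen_domain s n) (convex_domain s n) hF hL hper
      (fun y hy u v w => rescaled_closed hΩθ hf hfθ hy u v w) t t' hy hp
    rw [hLdef, hLdef, ht, ht'] at this
    exact this
  have hopι : ∀ z, ι (aeval Λ.Rᵀ (D i) *ᵥ z) = Λ.op (D i) (ι z) := fun z =>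
    Prod.ext (funext fun j => by rw [op_fst]; simp [ι]) (by rw [op_snd]; rfl)
  refine Λ.isDiagonalizable_aeval hM (D i) fun μ x y hx hy => ?_
  -- The averaged form at the base point `p`, restricted to `ℂ^n`; the factor of the similitude is
  -- `e^{-σ}`.
  refine eq_zero_of_similitude (fun z z' => average L (rescaled Ω f (ι z) (ι z')) p)
    (fun u v w => by rw [map_add, hadd])
    (fun u v w => by rw [hswap, map_add, hadd, hswap _ (ι u), hswap _ (ι u)]; ring)
    (fun c u v => by rw [hsmul', hsmul])
    (fun c u v => by rw [hswap, hsmul', hsmul, hswap _ (ι u)]; ring)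
    (fun u => ?_) (fun u v => ?_) (fun u hu => ?_) (Matrix.mulVecLin (aeval Λ.Rᵀ (D i)))
    (Real.exp_pos (-σ)) (fun u v => ?_) hx hy
  · have := hswap (ι u) (ι u)
    linarith
  · simp only [average, map_smul]
    exact integral_congr_ae (.of_forall fun x => by
      simp only [rescaled, hherm _ (hL p hp x)])
  · refine average_pos (hF _ _).continuousOn hL (fun y hy => ?_) hp
    rw [map_smul]
    exact mul_pos (Real.exp_pos _) (hpos y hy _ fun h0 => hu (congrArg Prod.snd h0))
  -- Constancy moves the left side from `p` to its image under `g i`. The unimodular substitution `x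
  -- ↦ D i (M)ᵀ x` then turns the integration points into images under `g i` of points `p + L x`,
  -- where `rescaled_op` applies.
  · rw [Matrix.mulVecLin_apply, Matrix.mulVecLin_apply,
      ← hconst _ _ _ (op_mem_domain Λ (hD.pos i) hp), hopι, hopι, average,
      ← setIntegral_cube_mulVec
        (φ := fun x => rescaled Ω f (Λ.op (D i) (ι u)) (Λ.op (D i) (ι v)) (Λ.op (D i) p + L x))
        (fun l x => by
          rw [map_add, add_comm (L _), ← add_assoc,
            hper l _ (hL _ (op_mem_domain Λ (hD.pos i) hp) x)])
        (aeval M (D i))ᵀ (by rw [Matrix.det_transpose, hD.det]), average, ← integral_const_mul]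
    refine integral_congr_ae (.of_forall fun x => ?_)
    have h1 : L (((aeval M (D i))ᵀ).map (Int.cast : ℤ → ℝ) *ᵥ x) = Λ.op (D i) (L x) :=
      (Λ.op_lin (D i) x).symm
    simp only [h1, ← map_add]
    exact rescaled_op hσ (hL p hp x) _ _

end LCK

end

end DirichletManifold

end

theorem theorem7p1 {N s n : ℕ} (M : Matrix (Fin N) (Fin N) ℤ) (hdet : M.det = 1)
    (hM : DirichletManifold.IsTypeJ M)
    (Λ : DirichletManifold.SpectralData M s n)
    (D : Fin s → ℤ[X])
    (hD : DirichletManifold.IsPrimaryDirichletFamily M Λ.α D)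
    (hnd : ∃ i, ¬ DirichletManifold.IsDiagonalizable
      ((Polynomial.aeval M (D i)).map (Int.cast : ℤ → ℂ))) :
    ¬ DirichletManifold.AdmitsLCK (DirichletManifold.Model s n)
        (DirichletManifold.T hM hD.toIsDirichletFamily) ∧
    ¬ DirichletManifold.AdmitsKahler (DirichletManifold.Model s n)
        (DirichletManifold.T hM hD.toIsDirichletFamily) := by
  obtain ⟨i, hi⟩ := hnd
  have h : ¬ DirichletManifold.AdmitsLCK (DirichletManifold.Model s n)
      (DirichletManifold.T hM hD.toIsDirichletFamily) := fun h =>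
    hi (DirichletManifold.isDiagonalizable_of_admitsLCK hM hD h i)
  exact ⟨h, fun h' => h h'.admitsLCK⟩
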